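/- Let $n\ge 1$ and $m\ge 0$ be integers and let $q\in\mathbb C$ with $0<|q|<1$. Write $(a)_k=\prod_{i=0}^{k-1}(1-aq^i)$ for $k\ge 0$, $(a)_\infty=\prod_{i\ge 0}(1-aq^i)$, and $|\boldsymbol k|=k_1+\cdots+k_n$ for $\boldsymbol k=(k_1,\dots,k_n)\in\mathbb Z_{\ge 0}^n$. Let $x_1,\dots,x_n$ be nonzero complex numbers such that no denominator below vanishes, that is, $x_r/x_s\ne q^i$ for all $r\ne s$ and all $i\in\mathbb Z$. Put $$\Delta(\boldsymbol k)=\prod_{1\le r<s\le n}\frac{1-q^{k_r-k_s}x_r/x_s}{1-x_r/x_s},$$ $$W(\boldsymbol k)=\frac{\Delta(\boldsymbol k)}{\prod_{r,s=1}^n(qx_r/x_s)_{k_r}}\,(-1)^{n|\boldsymbol k|}\,q^{\sum_{r=1}^n(r-1)k_r+n\sum_{r=1}^n\binom{k_r}{2}}\prod_{r=1}^n x_r^{nk_r-|\boldsymbol k|},$$ and, for a function $g:\mathbb Z_{\ge0}\to\mathbb C$, $$I_{\boldsymbol k}[g]=\sum_{\substack{0\le j_r\le k_r\\ r=1,\dots,n}}\Delta(\boldsymbol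 j)\prod_{r,s=1}^n\frac{(q^{-k_s}x_r/x_s)_{j_r}}{(qx_r/x_s)_{j_r}}\;g(|\boldsymbol j|)\;q^{\sum_{r=1}^n rj_r}.$$ Then the following four identities hold, the series over $\boldsymbol k$ being absolutely convergent: (1) $\displaystyle (q)_\infty^{m+1}=\sum_{\boldsymbol k\in\mathbb Z_{\ge0}^n}W(\boldsymbol k)\,(1-q^{2|\boldsymbol k|+1})\,(q)_{|\boldsymbol k|}\;I_{\boldsymbol k}\big[M\mapsto (q^{|\boldsymbol k|+1})_M\,(q)_M^m\big];$ (2) $\displaystyle (q)_\infty^{m+1}=1+\sum_{\boldsymbol k\in\mathbb Z_{\ge0}^n,\ |\boldsymbol k|\ge1}W(\boldsymbol k)\,(1-q^{2|\boldsymbol k|})\,(q)_{|\boldsymbol k|-1}\;I_{\boldsymbol k}\big[M\mapsto (q^{|\boldsymbol k|})_M\,(q)_M^m\big];$ (3) $\displaystyle \frac1{(q)_\infty^{m}}=\sum_{\boldsymbol k\in\mathbb Z_{\ge0}^n}W(\boldsymbol k)\,(1-q^{2|\boldsymbol k|+1})\,(q)_{|\boldsymbol k|}\;I_{\boldsymbol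 k}\Big[M\mapsto \frac{(q^{|\boldsymbol k|+1})_M}{(q)_M^{m+1}}\Big];$ (4) $\displaystyle \frac1{(q)_\infty^{m}}=1+\sum_{\boldsymbol k\in\mathbb Z_{\ge0}^n,\ |\boldsymbol k|\ge1}W(\boldsymbol k)\,(1-q^{2|\boldsymbol k|})\,(q)_{|\boldsymbol k|-1}\;I_{\boldsymbol k}\Big[M\mapsto \frac{(q^{|\boldsymbol k|})_M}{(q)_M^{m+1}}\Big].$ -/

import Mathlib

open scoped BigOperators

noncomputable section

/-- The finite `q`-shifted factorial `(a)_k = (a; q)_k = ∏_{0 ≤ i < k} (1 - a q^i)`. -/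
def qPoch (q a : ℂ) (k : ℕ) : ℂ :=
  ∏ i ∈ Finset.range k, (1 - a * q ^ i)

/-- The infinite `q`-shifted factorial `(a)_∞ = (a; q)_∞ = ∏_{i ≥ 0} (1 - a q^i)`. -/
def qPochInf (q a : ℂ) : ℂ :=
  ∏' i : ℕ, (1 - a * q ^ i)

/-- `|k| = k₁ + ⋯ + kₙ` for a multi-index `k`. -/
def absIdx {n : ℕ} (k : Fin n → ℕ) : ℕ :=
  ∑ r, k r

/-- The `A_n` factor `∏_{r < s} (1 - q^{k_r - k_s} x_r / x_s) / (1 - x_r / x_s)`. -/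
def anFactor {n : ℕ} (q : ℂ) (x : Fin n → ℂ) (k : Fin n → ℕ) : ℂ :=
  ∏ r : Fin n, ∏ s ∈ Finset.Ioi r,
    (1 - q ^ ((k r : ℤ) - (k s : ℤ)) * (x r / x s)) / (1 - x r / x s)

/-- The part of the outer summand that is common to all the expansions:
`∏_{r<s} (1 - q^{k_r-k_s} x_r/x_s)/(1 - x_r/x_s) · 1 / ∏_{r,s} (q x_r/x_s)_{k_r}`
`· (-1)^{n|k|} q^{∑ (r-1) k_r + n ∑ C(k_r, 2)} ∏ x_r^{n k_r - |k|}`.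
Indices in `Fin n` start at `0`, so the weight `r - 1` is the value of the index. -/
def outerFactor {n : ℕ} (q : ℂ) (x : Fin n → ℂ) (k : Fin n → ℕ) : ℂ :=
  anFactor q x k / (∏ r : Fin n, ∏ s : Fin n, qPoch q (q * (x r / x s)) (k r))
    * (-1) ^ (n * absIdx k)
    * q ^ ((∑ r : Fin n, (r : ℕ) * k r) + n * ∑ r : Fin n, (k r).choose 2)
    * ∏ r : Fin n, x r ^ ((n : ℤ) * (k r : ℤ) - (absIdx k : ℤ))

/-- The inner finite sum over all `j` with `0 ≤ j_r ≤ k_r`: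
`∑_j ∏_{r<s} (1 - q^{j_r-j_s} x_r/x_s)/(1 - x_r/x_s)`
`· ∏_{r,s} (q^{-k_s} x_r/x_s)_{j_r} / (q x_r/x_s)_{j_r} · g(|j|) · q^{∑ r j_r}`. -/
def innerSum {n : ℕ} (q : ℂ) (x : Fin n → ℂ) (k : Fin n → ℕ) (g : ℕ → ℂ) : ℂ :=
  ∑ j ∈ Fintype.piFinset (fun r => Finset.range (k r + 1)),
    anFactor q x j
      * (∏ r : Fin n, ∏ s : Fin n,
          qPoch q (q ^ (-(k s : ℤ)) * (x r / x s)) (j r) / qPoch q (q * (x r / x s)) (j r))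
      * g (absIdx j)
      * q ^ (∑ r : Fin n, ((r : ℕ) + 1) * j r)

/-- The summand of the expansions over all multi-indices `k`; the inner weight is `g |k| |j|`. -/
def fullTerm {n : ℕ} (q : ℂ) (x : Fin n → ℂ) (g : ℕ → ℕ → ℂ) (k : Fin n → ℕ) : ℂ :=
  outerFactor q x k * ((1 - q ^ (2 * absIdx k + 1)) * qPoch q q (absIdx k))
    * innerSum q x k (g (absIdx k))

/-- The summand of the expansions over the multi-indices `k` with `|k| ≥ 1`;
the inner weight is `g |k| |j|`. -/
def posTerm {n : ℕ} (q : ℂ) (x : Fin n → ℂ) (g : ℕ → ℕ → ℂ) (k : Fin n → ℕ) : ℂ :=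
  outerFactor q x k * ((1 - q ^ (2 * absIdx k)) * qPoch q q (absIdx k - 1))
    * innerSum q x k (g (absIdx k))

end

/-! Milne's fundamental `A_n` sum reduces everything to one variable. A Vandermonde quotient times
factors `(u_s - a_s q^i x_r/x_s) / (1 - q^(i+1) x_r/x_s)`, summed over `|k| = K`, depends only on `∏
u_s` and `∏ a_s` (`sum_milneTerm`); this follows from Lagrange interpolation at the nodes `x_r
q^(k_r)`. The choice `u_s = 1`, `a_s = q^(-k_s)` collapses the inner sum to one depending on `|k|`
alone (`innerSum_eq`); the choice `u_s = 0`, `a_s = 1` then collapses the outer sum over each degree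
(`sum_outerFactor`).

In one variable the series telescopes. Let `e = 1` for (1), (3) and `e = 0` for (2), (4), let
`(q^(K+e))_J h(J)` be the inner weight and `H_J = h(J)/(q)_J`. The part of degree `K ≥ 1` is `P_K -
P_(K-1)`, where `P_N` is the sum over `d + J = N` of `(-1)^d q^(d(d+1)/2) / (q)_d · (q)_(2J+d+e)
H_J` (`mul_radialFactor_succ`). Dominated convergence and Euler's expansion of `(q)_∞` give `P_N →
(q)_∞^2 lim H`; the choices `h = (q)_J^m` and `h = (q)_J^(-m-1)` yield the stated values.

Absolute convergence needs more, since terms of equal degree may cancel.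
`exists_sum_norm_outerFactor_le` shows that the norms of the outer factors in degree `K` add up to
at most a constant times `|q|^(K choose 2)`, the size of the collapsed factor, and the increments of
`P` are `O(|q|^N)`. -/

section

open Filter Topology

/-! ### Lagrange interpolation and Milne's fundamental sum -/

/-- Lagrange interpolation at zero of a product of `n` linear factors over `n` nodes. -/
theorem sum_prod_linear_div_prod_one_sub {ι : Type*} [Fintype ι] [DecidableEq ι]
    (y u b : ι → ℂ) (hy : Function.Injective y) (hy0 : ∀ r, y r ≠ 0) :
    ∑ r, (∏ s, (u s - b s * y r)) / ∏ s ∈ Finset.univ.erase r, (1 - y r / y s)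
      = ∏ s, u s - ∏ s, (b s * y s) := by
  classical
  set P : Polynomial ℂ := ∏ s, (Polynomial.C (u s) - Polynomial.C (b s) * Polynomial.X) with hP
  set Q : Polynomial ℂ := ∏ s, (Polynomial.X - Polynomial.C (y s)) with hQ
  set l : ℂ := ∏ s, (-b s) with hl
  have hdeg1 : ∀ s, (Polynomial.C (u s) - Polynomial.C (b s) * Polynomial.X).natDegree ≤ 1 := by
    intro s
    refine (Polynomial.natDegree_sub_le _ _).trans ?_
    simp only [Polynomial.natDegree_C, max_le_iff, zero_le, true_and]
    exact (Polynomial.natDegree_C_mul_le _ _).trans Polynomial.natDegree_X_le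
  have hdP : P.natDegree ≤ Fintype.card ι := by
    refine (Polynomial.natDegree_prod_le _ _).trans ?_
    refine (Finset.sum_le_sum fun s _ => hdeg1 s).trans ?_
    simp
  have hcP : P.coeff (Fintype.card ι) = l := by
    have := Polynomial.coeff_prod_of_natDegree_le (s := Finset.univ)
      (fun s => Polynomial.C (u s) - Polynomial.C (b s) * Polynomial.X) 1 (fun s _ => hdeg1 s)
    simpa [hl] using this
  have hQm : Q.Monic := Polynomial.monic_prod_of_monic _ _ fun s _ => Polynomial.monic_X_sub_C _
  have hdQ : Q.natDegree = Fintype.card ι := by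
    simp [hQ, Polynomial.natDegree_prod_of_monic _ _ fun s _ => Polynomial.monic_X_sub_C (y s)]
  -- Subtracting the top coefficient times the nodal polynomial lowers the degree below the number
  -- of nodes without changing the values there.
  set R : Polynomial ℂ := P - Polynomial.C l * Q with hR
  have hdR : R.degree < (Finset.univ : Finset ι).card := by
    rw [Finset.card_univ, Polynomial.degree_lt_iff_coeff_zero]
    intro m hm
    rcases hm.eq_or_lt with rfl | hm
    · have : Q.coeff (Fintype.card ι) = 1 := by rw [← hdQ]; exact hQm.coeff_natDegree
      simp [hR, hcP, this]
    · rw [hR, Polynomial.coeff_sub, Polynomial.coeff_C_mul,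
        Polynomial.coeff_eq_zero_of_natDegree_lt (hdP.trans_lt hm),
        Polynomial.coeff_eq_zero_of_natDegree_lt (hdQ.le.trans_lt hm)]
      simp
  have hRy : ∀ r, R.eval (y r) = ∏ s, (u s - b s * y r) := by
    intro r
    have : Q.eval (y r) = 0 := by
      rw [hQ, Polynomial.eval_prod]
      exact Finset.prod_eq_zero (Finset.mem_univ r) (by simp)
    simp [hR, this, hP, Polynomial.eval_prod]
  have hR0 : R.eval 0 = ∏ s, u s - ∏ s, (b s * y s) := by
    simp [hR, hP, hQ, hl, Polynomial.eval_prod, ← Finset.prod_mul_distrib]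
  have hint := Lagrange.eq_interpolate (s := Finset.univ) (v := y) hy.injOn hdR
  rw [← hR0, hint, Lagrange.interpolate_apply, Polynomial.eval_finsetSum]
  refine Finset.sum_congr rfl fun r _ => ?_
  rw [Polynomial.eval_mul, Polynomial.eval_C, hRy, div_eq_mul_inv, Lagrange.basis,
    Polynomial.eval_prod, ← Finset.prod_inv_distrib]
  congr 1
  refine Finset.prod_congr rfl fun s hs => ?_
  have hsr : y r - y s ≠ 0 := sub_ne_zero.2 fun h => (Finset.ne_of_mem_erase hs) (hy h).symm
  have h2 : y s - y r ≠ 0 := by rw [← neg_sub]; exact neg_ne_zero.2 hsr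
  have h3 : 1 - y r / y s = (y s - y r) / y s := by field_simp [hy0 s]
  rw [h3, Lagrange.basisDivisor]
  simp
  field_simp
  ring

/-- A product over pairs of a symmetric function that is `1` away from the index `r`. -/
theorem prod_Ioi_eq_prod_erase {n : ℕ} (h : Fin n → Fin n → ℂ) (r : Fin n)
    (hsymm : ∀ i j, h i j = h j i) (h1 : ∀ i j, i ≠ r → j ≠ r → h i j = 1) :
    ∏ i, ∏ j ∈ Finset.Ioi i, h i j = ∏ s ∈ Finset.univ.erase r, h r s := by
  have hinner : ∀ i, i ≠ r → ∏ j ∈ Finset.Ioi i, h i j = if i < r then h r i else 1 := by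
    intro i hi
    split_ifs with hir
    · rw [hsymm r i]
      exact Finset.prod_eq_single_of_mem r (Finset.mem_Ioi.2 hir) fun j _ hj => h1 i j hi hj
    · refine Finset.prod_eq_one fun j hj => h1 i j hi ?_
      rintro rfl
      exact hir (Finset.mem_Ioi.1 hj)
  rw [← Finset.mul_prod_erase _ _ (Finset.mem_univ r)]
  rw [Finset.prod_congr rfl fun i hi => hinner i (Finset.ne_of_mem_erase hi)]
  have : ∏ j ∈ Finset.Ioi r, h r j
      = ∏ i ∈ Finset.univ.erase r, if ¬ i < r then h r i else 1 := by
    rw [← Finset.prod_filter]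
    refine Finset.prod_congr ?_ fun _ _ => rfl
    ext j
    simp only [Finset.mem_Ioi, Finset.mem_filter, Finset.mem_erase, Finset.mem_univ, and_true]
    grind
  rw [this, ← Finset.prod_mul_distrib]
  refine Finset.prod_congr rfl fun i _ => ?_
  by_cases hir : i < r <;> simp [hir]

/-- The Vandermonde ratio `∏_{r<s} (x_r q^{k_r} - x_s q^{k_s}) / (x_r - x_s)`. -/
noncomputable def vandRatio {n : ℕ} (q : ℂ) (x : Fin n → ℂ) (k : Fin n → ℕ) : ℂ :=
  ∏ r : Fin n, ∏ s ∈ Finset.Ioi r, (x r * q ^ k r - x s * q ^ k s) / (x r - x s)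

theorem prod_pow_val {n : ℕ} (q : ℂ) (k : Fin n → ℕ) :
    ∏ r : Fin n, ∏ s ∈ Finset.Ioi r, q ^ k s = q ^ ∑ r : Fin n, (r : ℕ) * k r := by
  rw [Finset.prod_comm' (t' := Finset.univ) (s' := fun s => Finset.Iio s) (by simp)]
  rw [← Finset.prod_pow_eq_pow_sum]
  refine Finset.prod_congr rfl fun s _ => ?_
  rw [Finset.prod_const, Fin.card_Iio, ← pow_mul, mul_comm]

/-- Each index `s` is the larger one in `s` pairs (counting from `0`), so the power of `q` clears
the `q^(-k_s)` in every pair. -/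
theorem anFactor_mul_pow {n : ℕ} {q : ℂ} (hq : q ≠ 0) {x : Fin n → ℂ} (hx0 : ∀ r, x r ≠ 0)
    (k : Fin n → ℕ) :
    anFactor q x k * q ^ (∑ r : Fin n, (r : ℕ) * k r) = vandRatio q x k := by
  rw [← prod_pow_val, anFactor, vandRatio, ← Finset.prod_mul_distrib]
  refine Finset.prod_congr rfl fun r _ => ?_
  rw [← Finset.prod_mul_distrib]
  refine Finset.prod_congr rfl fun s _ => ?_
  have hs := hx0 s
  rw [zpow_sub₀ hq, zpow_natCast, zpow_natCast]
  have hqs : q ^ k s ≠ 0 := pow_ne_zero _ hq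
  have h1 : 1 - x r / x s = (x r - x s) * (-1 / x s) := by field_simp; ring
  have h2 : (1 - q ^ k r / q ^ k s * (x r / x s)) * q ^ k s
    = (x r * q ^ k r - x s * q ^ k s) * (-1 / x s) := by field_simp; ring
  rw [div_mul_eq_mul_div, h2, h1, mul_div_mul_right]
  simpa using hs

/-- The summand of Milne's fundamental sum, in homogeneous form. -/
noncomputable def milneTerm {n : ℕ} (q : ℂ) (x u a : Fin n → ℂ) (k : Fin n → ℕ) : ℂ :=
  vandRatio q x k * ∏ r, ∏ s, ∏ i ∈ Finset.range (k r),
    ((u s - a s * q ^ i * (x r / x s)) / (1 - q ^ (i + 1) * (x r / x s)))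

/-- The one-step transition weight in the recurrence for Milne's fundamental sum. -/
noncomputable def milneStep {n : ℕ} (q : ℂ) (x u a : Fin n → ℂ) (k : Fin n → ℕ) (r : Fin n) : ℂ :=
  (∏ s, (u s - a s * q ^ k r * (x r / x s))) /
    ∏ s ∈ Finset.univ.erase r, (1 - (x r * q ^ k r) / (x s * q ^ k s))

section
variable {n : ℕ} {q : ℂ} {x : Fin n → ℂ}

theorem mul_pow_injective (hq : q ≠ 0) (hx0 : ∀ r, x r ≠ 0)
    (hx : ∀ r s : Fin n, r ≠ s → ∀ i : ℤ, x r / x s ≠ q ^ i) (k : Fin n → ℕ) :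
    Function.Injective fun r => x r * q ^ k r := by
  intro r s h
  by_contra hrs
  apply hx r s hrs ((k s : ℤ) - k r)
  rw [zpow_sub₀ hq, zpow_natCast, zpow_natCast]
  have := hx0 s
  have h1 := pow_ne_zero (k r) hq
  field_simp
  exact h

/-- Interpolation at the nodes `x_r q^(k_r)` with `b_s = a_s / x_s`. -/
theorem sum_milneStep (hq : q ≠ 0) (hx0 : ∀ r, x r ≠ 0)
    (hx : ∀ r s : Fin n, r ≠ s → ∀ i : ℤ, x r / x s ≠ q ^ i) (u a : Fin n → ℂ) (k : Fin n → ℕ) :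
    ∑ r, milneStep q x u a k r = ∏ s, u s - (∏ s, a s) * q ^ absIdx k := by
  have h := sum_prod_linear_div_prod_one_sub (fun r => x r * q ^ k r) u (fun s => a s / x s)
    (mul_pow_injective hq hx0 hx k) fun r => mul_ne_zero (hx0 r) (pow_ne_zero _ hq)
  rw [absIdx, ← Finset.prod_pow_eq_pow_sum, ← Finset.prod_mul_distrib]
  convert h using 2
  · unfold milneStep
    congr 1
    refine Finset.prod_congr rfl fun s _ => ?_
    ring
  · refine Finset.prod_congr rfl fun s _ => ?_
    have := hx0 s
    field_simp

theorem vandRatio_add_single (hq : q ≠ 0) (hx0 : ∀ r, x r ≠ 0)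
    (hx : ∀ r s : Fin n, r ≠ s → ∀ i : ℤ, x r / x s ≠ q ^ i) (k : Fin n → ℕ) (r : Fin n) :
    vandRatio q x (k + Pi.single r 1) = vandRatio q x k *
      ∏ s ∈ Finset.univ.erase r,
        ((x r * q ^ (k r + 1) - x s * q ^ k s) / (x r * q ^ k r - x s * q ^ k s)) := by
  have hne : ∀ (l : Fin n → ℕ) i j, i ≠ j → x i * q ^ l i - x j * q ^ l j ≠ 0 := fun l i j hij =>
    sub_ne_zero.2 fun h => hij (mul_pow_injective hq hx0 hx l h)
  set X : Fin n → ℂ := fun i => x i * q ^ k i with hX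
  set Y : Fin n → ℂ := fun i => x i * q ^ (k + Pi.single r 1 : Fin n → ℕ) i with hY
  have hYr : Y r = x r * q ^ (k r + 1) := by simp [hY]
  have hYs : ∀ s, s ≠ r → Y s = X s := fun s hs => by simp [hY, hX, hs]
  -- The diagonal is set to `1` by hand: there the quotient is `0 / 0 = 0`, while the lemma asks for
  -- `1` at all pairs avoiding `r`.
  have key := prod_Ioi_eq_prod_erase (fun i j => if i = j then 1 else (Y i - Y j) / (X i - X j)) r
    (by
      intro i j
      rcases eq_or_ne i j with rfl | h
      · rfl
      · rw [if_neg h, if_neg h.symm, ← neg_sub (Y j), ← neg_sub (X j), neg_div_neg_eq])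
    (by
      intro i j hi hj
      split_ifs with h
      · rfl
      · rw [hYs i hi, hYs j hj, div_self (hne k i j h)])
  have h2 : ∏ s ∈ Finset.univ.erase r,
        ((x r * q ^ (k r + 1) - x s * q ^ k s) / (x r * q ^ k r - x s * q ^ k s))
      = ∏ s ∈ Finset.univ.erase r, (fun i j => if i = j then 1 else (Y i - Y j) / (X i - X j)) r s := by
    refine Finset.prod_congr rfl fun s hs => ?_
    have hs' := Finset.ne_of_mem_erase hs
    dsimp only
    rw [if_neg hs'.symm, hYr, hYs s hs']
  rw [h2, ← key, vandRatio, vandRatio, ← Finset.prod_mul_distrib]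
  refine Finset.prod_congr rfl fun i _ => ?_
  rw [← Finset.prod_mul_distrib]
  refine Finset.prod_congr rfl fun j hj => ?_
  have hij : i ≠ j := (Finset.mem_Ioi.1 hj).ne
  rw [if_neg hij]
  have := hne k i j hij
  change (Y i - Y j) / _ = (X i - X j) / _ * _
  rw [div_mul_div_comm, mul_comm (X i - X j), mul_div_mul_right _ _ this]

theorem one_sub_pow_mul_div_ne_zero (hq0 : 0 < ‖q‖) (hq1 : ‖q‖ < 1) (hx0 : ∀ r, x r ≠ 0)
    (hx : ∀ r s : Fin n, r ≠ s → ∀ i : ℤ, x r / x s ≠ q ^ i) (r s : Fin n) (i : ℕ) :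
    1 - q ^ (i + 1) * (x r / x s) ≠ 0 := by
  have hq : q ≠ 0 := norm_pos_iff.1 hq0
  rw [sub_ne_zero]
  rcases eq_or_ne r s with rfl | hrs
  · rw [div_self (hx0 r), mul_one]
    intro h
    have := congrArg norm h
    rw [norm_one, norm_pow] at this
    exact (pow_lt_one₀ hq0.le hq1 i.succ_ne_zero).ne' this
  · intro h
    refine hx r s hrs (-((i + 1 : ℕ) : ℤ)) ?_
    rw [zpow_neg, zpow_natCast]
    exact eq_inv_of_mul_eq_one_right h.symm

/-- A detailed-balance relation. Raising `k_r` adds the factors with `i = k_r`; their denominators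
are the numerator of the backward step with `u = a = 1`, and the change of the Vandermonde quotient
turns one node denominator into the other. -/
theorem milneTerm_mul_milneStep (hq0 : 0 < ‖q‖) (hq1 : ‖q‖ < 1) (hx0 : ∀ r, x r ≠ 0)
    (hx : ∀ r s : Fin n, r ≠ s → ∀ i : ℤ, x r / x s ≠ q ^ i) (u a : Fin n → ℂ) (k : Fin n → ℕ)
    (r : Fin n) :
    milneTerm q x u a (k + Pi.single r 1) *
        milneStep q x (fun _ => 1) (fun _ => 1) (k + Pi.single r 1) r
      = milneTerm q x u a k * milneStep q x u a k r := by
  have hq : q ≠ 0 := norm_pos_iff.1 hq0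
  have hne : ∀ (l : Fin n → ℕ) i j, i ≠ j → x i * q ^ l i - x j * q ^ l j ≠ 0 := fun l i j hij =>
    sub_ne_zero.2 fun h => hij (mul_pow_injective hq hx0 hx l h)
  have hprod : (∏ t, ∏ s, ∏ i ∈ Finset.range ((k + Pi.single r 1 : Fin n → ℕ) t),
        ((u s - a s * q ^ i * (x t / x s)) / (1 - q ^ (i + 1) * (x t / x s))))
      = (∏ t, ∏ s, ∏ i ∈ Finset.range (k t),
        ((u s - a s * q ^ i * (x t / x s)) / (1 - q ^ (i + 1) * (x t / x s)))) *
        ∏ s, ((u s - a s * q ^ k r * (x r / x s)) / (1 - q ^ (k r + 1) * (x r / x s))) := by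
    rw [← Finset.mul_prod_erase _ _ (Finset.mem_univ r),
      ← Finset.mul_prod_erase Finset.univ (fun t => ∏ s, ∏ i ∈ Finset.range (k t),
        ((u s - a s * q ^ i * (x t / x s)) / (1 - q ^ (i + 1) * (x t / x s)))) (Finset.mem_univ r)]
    have h1 : (k + Pi.single r 1 : Fin n → ℕ) r = k r + 1 := by simp
    rw [h1]
    simp_rw [Finset.prod_range_succ]
    rw [Finset.prod_mul_distrib, mul_right_comm]
    congr 1
    congr 1
    refine Finset.prod_congr rfl fun t ht => ?_
    simp [Finset.ne_of_mem_erase ht]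
  have hA : ∏ s, (1 - 1 * q ^ (k r + 1) * (x r / x s)) ≠ 0 :=
    Finset.prod_ne_zero_iff.2 fun s _ => by
      rw [one_mul]; exact one_sub_pow_mul_div_ne_zero hq0 hq1 hx0 hx r s _
  have hE : (∏ s ∈ Finset.univ.erase r,
        ((x r * q ^ (k r + 1) - x s * q ^ k s) / (x r * q ^ k r - x s * q ^ k s))) /
        (∏ s ∈ Finset.univ.erase r, (1 - (x r * q ^ (k r + 1)) / (x s * q ^ k s)))
      = 1 / ∏ s ∈ Finset.univ.erase r, (1 - (x r * q ^ k r) / (x s * q ^ k s)) := by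
    rw [← Finset.prod_div_distrib, one_div, ← Finset.prod_inv_distrib]
    refine Finset.prod_congr rfl fun s hs => ?_
    have hs' := Finset.ne_of_mem_erase hs
    have h1 := hne k r s hs'.symm
    have h2 : x r * q ^ (k r + 1) - x s * q ^ k s ≠ 0 := by
      have h := hne (k + Pi.single r 1) r s hs'.symm
      simp only [Pi.add_apply, Pi.single_eq_same, Pi.single_eq_of_ne hs', add_zero] at h
      exact h
    have hs0 : x s * q ^ k s ≠ 0 := mul_ne_zero (hx0 s) (pow_ne_zero _ hq)
    rw [one_sub_div hs0, one_sub_div hs0, inv_div]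
    generalize x s * q ^ k s = S at *
    generalize x r * q ^ (k r + 1) = R1 at *
    generalize x r * q ^ k r = R at *
    have h3 : S - R ≠ 0 := by rw [← neg_sub]; exact neg_ne_zero.2 h1
    have h4 : S - R1 ≠ 0 := by rw [← neg_sub]; exact neg_ne_zero.2 h2
    field_simp
    ring
  unfold milneTerm milneStep
  rw [hprod, vandRatio_add_single hq hx0 hx]
  have h1 : (k + Pi.single r 1 : Fin n → ℕ) r = k r + 1 := by simp
  have h2 : ∏ s ∈ Finset.univ.erase r,
        (1 - (x r * q ^ (k r + 1)) / (x s * q ^ (k + Pi.single r 1 : Fin n → ℕ) s))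
      = ∏ s ∈ Finset.univ.erase r, (1 - (x r * q ^ (k r + 1)) / (x s * q ^ k s)) := by
    refine Finset.prod_congr rfl fun s hs => ?_
    simp [Finset.ne_of_mem_erase hs]
  have hN : ∏ s, ((u s - a s * q ^ k r * (x r / x s)) / (1 - q ^ (k r + 1) * (x r / x s)))
      = (∏ s, (u s - a s * q ^ k r * (x r / x s))) /
        ∏ s, (1 - 1 * q ^ (k r + 1) * (x r / x s)) := by
    rw [Finset.prod_div_distrib]
    simp only [one_mul]
  rw [h1, h2, hN,
    div_eq_mul_one_div _ (∏ s ∈ Finset.univ.erase r, (1 - x r * q ^ k r / (x s * q ^ k s))), ← hE]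
  generalize ∏ s, (1 - 1 * q ^ (k r + 1) * (x r / x s)) = D at hA ⊢
  generalize ∏ s ∈ Finset.univ.erase r, (1 - (x r * q ^ (k r + 1)) / (x s * q ^ k s)) = B
  generalize (∏ s ∈ Finset.univ.erase r, ((x r * q ^ (k r + 1) - x s * q ^ k s) /
    (x r * q ^ k r - x s * q ^ k s))) = A
  generalize ∏ s, (u s - a s * q ^ k r * (x r / x s)) = N
  field_simp

theorem milneStep_one_eq_zero (hx0 : ∀ r, x r ≠ 0) (k : Fin n → ℕ) (r : Fin n) (hk : k r = 0) :
    milneStep q x (fun _ => 1) (fun _ => 1) k r = 0 := by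
  unfold milneStep
  rw [Finset.prod_eq_zero (Finset.mem_univ r), zero_div]
  simp [hk, hx0 r]

theorem absIdx_add_single (k : Fin n → ℕ) (r : Fin n) :
    absIdx (k + Pi.single r 1) = absIdx k + 1 := by
  simp [absIdx, Finset.sum_add_distrib]

theorem mem_piAntidiag_univ {K : ℕ} {k : Fin n → ℕ} :
    k ∈ Finset.piAntidiag Finset.univ K ↔ absIdx k = K := by
  simp [absIdx]

/-- Milne's fundamental `A_n` sum. -/
theorem sum_milneTerm (hq0 : 0 < ‖q‖) (hq1 : ‖q‖ < 1) (hx0 : ∀ r, x r ≠ 0)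
    (hx : ∀ r s : Fin n, r ≠ s → ∀ i : ℤ, x r / x s ≠ q ^ i) (u a : Fin n → ℂ) (K : ℕ) :
    ∑ k ∈ Finset.piAntidiag Finset.univ K, milneTerm q x u a k
      = ∏ i ∈ Finset.range K, ((∏ s, u s - (∏ s, a s) * q ^ i) / (1 - q ^ (i + 1))) := by
  have hq : q ≠ 0 := norm_pos_iff.1 hq0
  induction K with
  | zero =>
    have : milneTerm q x u a 0 = 1 := by
      simp only [milneTerm, vandRatio, Pi.zero_apply, pow_zero, mul_one, Finset.range_zero,
        Finset.prod_empty, Finset.prod_const_one]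
      refine Finset.prod_eq_one fun i _ => Finset.prod_eq_one fun j hj => ?_
      have h := (mul_pow_injective hq hx0 hx 0).ne (Finset.mem_Ioi.1 hj).ne
      simp only [Pi.zero_apply, pow_zero, mul_one] at h
      exact div_self (sub_ne_zero.2 h)
    simp [this]
  | succ K ih =>
    have hK : 1 - q ^ (K + 1) ≠ 0 := by
      rw [sub_ne_zero]
      intro h
      have := congrArg norm h
      rw [norm_one, norm_pow] at this
      exact (pow_lt_one₀ hq0.le hq1 K.succ_ne_zero).ne' this
    rw [Finset.prod_range_succ, ← ih, mul_div_assoc', eq_div_iff hK, Finset.sum_mul,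
      Finset.sum_mul]
    -- Both scalar factors are expanded as sums of steps, `1 - q^(K+1)` backward from degree `K + 1`
    -- and `∏ u - (∏ a) q^K` forward from degree `K`; detailed balance then matches the two double
    -- sums along `k ↦ k + e_r`.
    have h1 : ∀ k ∈ Finset.piAntidiag (Finset.univ : Finset (Fin n)) (K + 1),
        milneTerm q x u a k * (1 - q ^ (K + 1))
          = ∑ r, milneTerm q x u a k * milneStep q x (fun _ => 1) (fun _ => 1) k r := by
      intro k hk
      rw [← Finset.mul_sum, sum_milneStep hq hx0 hx, mem_piAntidiag_univ.1 hk]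
      simp
    have h2 : ∀ k ∈ Finset.piAntidiag (Finset.univ : Finset (Fin n)) K,
        milneTerm q x u a k * (∏ s, u s - (∏ s, a s) * q ^ K)
          = ∑ r, milneTerm q x u a k * milneStep q x u a k r := by
      intro k hk
      rw [← Finset.mul_sum, sum_milneStep hq hx0 hx, mem_piAntidiag_univ.1 hk]
    rw [Finset.sum_congr rfl h1, Finset.sum_congr rfl h2, Finset.sum_comm,
      Finset.sum_comm (s := Finset.piAntidiag Finset.univ K)]
    refine Finset.sum_congr rfl fun r _ => ?_
    symm
    refine Finset.sum_of_injOn (fun k => k + Pi.single r 1) ?_ ?_ ?_ ?_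
    · intro k _ l _ h
      exact add_right_cancel h
    · intro k hk
      rw [Finset.mem_coe, mem_piAntidiag_univ] at hk ⊢
      rw [absIdx_add_single, hk]
    -- An index outside the image has `k_r = 0`, where the backward step vanishes.
    · intro k hk hk'
      rw [milneStep_one_eq_zero hx0 k r, mul_zero]
      by_contra hkr
      apply hk'
      have hk2 : (k - Pi.single r 1) + Pi.single r 1 = k := by
        ext s
        rcases eq_or_ne s r with rfl | hs
        · simp; omega
        · simp [hs]
      refine ⟨k - Pi.single r 1, ?_, hk2⟩
      rw [Finset.mem_coe, mem_piAntidiag_univ]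
      rw [mem_piAntidiag_univ] at hk
      have := absIdx_add_single (k - Pi.single r 1) r
      rw [hk2, hk] at this
      omega
    · intro k _
      exact (milneTerm_mul_milneStep hq0 hq1 hx0 hx u a k r).symm

/-! ### Collapse of the inner and outer sums to one variable -/

theorem innerSum_eq (hq0 : 0 < ‖q‖) (hq1 : ‖q‖ < 1) (hx0 : ∀ r, x r ≠ 0)
    (hx : ∀ r s : Fin n, r ≠ s → ∀ i : ℤ, x r / x s ≠ q ^ i) (k : Fin n → ℕ) (g : ℕ → ℂ) :
    innerSum q x k g = ∑ J ∈ Finset.range (absIdx k + 1),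
      qPoch q (q ^ (-(absIdx k : ℤ))) J / qPoch q q J * q ^ J * g J := by
  have hq : q ≠ 0 := norm_pos_iff.1 hq0
  have hterm : ∀ j : Fin n → ℕ, anFactor q x j
      * (∏ r : Fin n, ∏ s : Fin n,
          qPoch q (q ^ (-(k s : ℤ)) * (x r / x s)) (j r) / qPoch q (q * (x r / x s)) (j r))
      * g (absIdx j) * q ^ (∑ r : Fin n, ((r : ℕ) + 1) * j r)
      = milneTerm q x (fun _ => 1) (fun s => q ^ (-(k s : ℤ))) j
          * (q ^ absIdx j * g (absIdx j)) := by
    intro j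
    have h1 : q ^ (∑ r : Fin n, ((r : ℕ) + 1) * j r)
        = q ^ (∑ r : Fin n, (r : ℕ) * j r) * q ^ absIdx j := by
      rw [← pow_add, absIdx, ← Finset.sum_add_distrib]
      congr 1
      exact Finset.sum_congr rfl fun r _ => by ring
    have h2 : (∏ r : Fin n, ∏ s : Fin n,
          qPoch q (q ^ (-(k s : ℤ)) * (x r / x s)) (j r) / qPoch q (q * (x r / x s)) (j r))
        = ∏ r, ∏ s, ∏ i ∈ Finset.range (j r),
          ((1 - q ^ (-(k s : ℤ)) * q ^ i * (x r / x s)) / (1 - q ^ (i + 1) * (x r / x s))) := by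
      refine Finset.prod_congr rfl fun r _ => Finset.prod_congr rfl fun s _ => ?_
      rw [qPoch, qPoch, ← Finset.prod_div_distrib]
      refine Finset.prod_congr rfl fun i _ => ?_
      congr 1 <;> ring
    rw [h1, h2, milneTerm, ← anFactor_mul_pow hq hx0]
    ring
  unfold innerSum
  rw [Finset.sum_congr rfl fun j _ => hterm j]
  rw [← Finset.sum_fiberwise_of_maps_to (t := Finset.range (absIdx k + 1)) (g := absIdx)]
  swap
  · intro j hj
    rw [Finset.mem_range, Nat.lt_succ_iff]
    exact Finset.sum_le_sum fun r _ =>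
      Nat.lt_succ_iff.1 (Finset.mem_range.1 (Fintype.mem_piFinset.1 hj r))
  refine Finset.sum_congr rfl fun J _ => ?_
  have h3 : ∑ j ∈ (Fintype.piFinset fun r => Finset.range (k r + 1)) with absIdx j = J,
        milneTerm q x (fun _ => 1) (fun s => q ^ (-(k s : ℤ))) j * (q ^ absIdx j * g (absIdx j))
      = ∑ j ∈ Finset.piAntidiag Finset.univ J,
        milneTerm q x (fun _ => 1) (fun s => q ^ (-(k s : ℤ))) j * (q ^ J * g J) := by
    -- The box `j_r ≤ k_r` may be dropped: if `j_r > k_r`, the factor with `s = r` and `i = k_r` is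
    -- `1 - q^(-k_r) q^(k_r) = 0`.
    refine Finset.sum_subset_zero_on_sdiff ?_ ?_ ?_
    · intro j hj
      exact mem_piAntidiag_univ.2 (Finset.mem_filter.1 hj).2
    · intro j hj
      rw [Finset.mem_sdiff, mem_piAntidiag_univ, Finset.mem_filter, Fintype.mem_piFinset] at hj
      have hr : ∃ r, k r < j r := by
        by_contra! h
        exact hj.2 ⟨fun r => Finset.mem_range.2 (Nat.lt_succ_of_le (h r)), hj.1⟩
      obtain ⟨r, hr⟩ := hr
      have h0 : milneTerm q x (fun _ => 1) (fun s => q ^ (-(k s : ℤ))) j = 0 := by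
        unfold milneTerm
        refine mul_eq_zero_of_right _ (Finset.prod_eq_zero (Finset.mem_univ r)
          (Finset.prod_eq_zero (Finset.mem_univ r)
            (Finset.prod_eq_zero (Finset.mem_range.2 hr) ?_)))
        have h1 : q ^ (-(k r : ℤ)) * q ^ k r = 1 := by
          rw [zpow_neg, zpow_natCast, inv_mul_cancel₀ (pow_ne_zero _ hq)]
        rw [div_self (hx0 r), mul_one, h1, sub_self, zero_div]
      rw [h0, zero_mul]
    · intro j hj
      rw [(Finset.mem_filter.1 hj).2]
  rw [h3, ← Finset.sum_mul, sum_milneTerm hq0 hq1 hx0 hx, ← mul_assoc]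
  congr 2
  rw [qPoch, qPoch, ← Finset.prod_div_distrib]
  refine Finset.prod_congr rfl fun i _ => ?_
  have h4 : ∏ s, q ^ (-(k s : ℤ)) = q ^ (-(absIdx k : ℤ)) := by
    simp only [zpow_neg, zpow_natCast, Finset.prod_inv_distrib]
    rw [Finset.prod_pow_eq_pow_sum, absIdx]
  rw [h4, pow_succ', Finset.prod_const_one]

theorem prod_range_mul_pow (c q : ℂ) (K : ℕ) :
    ∏ i ∈ Finset.range K, (c * q ^ i) = c ^ K * q ^ K.choose 2 := by
  rw [Finset.prod_mul_distrib, Finset.prod_const, Finset.card_range, Finset.prod_pow_eq_pow_sum,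
    Finset.sum_range_id, Nat.choose_two_right]

theorem outerFactor_eq_milneTerm (hq : q ≠ 0) (hx0 : ∀ r, x r ≠ 0) (k : Fin n → ℕ) :
    outerFactor q x k = milneTerm q x (fun _ => 0) (fun _ => 1) k := by
  have h1 : ∏ r, ∏ s, ∏ i ∈ Finset.range (k r),
        ((0 - 1 * q ^ i * (x r / x s)) / (1 - q ^ (i + 1) * (x r / x s)))
      = ((-1) ^ (n * absIdx k) * q ^ (n * ∑ r : Fin n, (k r).choose 2) *
          ∏ r : Fin n, x r ^ ((n : ℤ) * (k r : ℤ) - (absIdx k : ℤ))) /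
        ∏ r : Fin n, ∏ s : Fin n, qPoch q (q * (x r / x s)) (k r) := by
    have h2 : ∀ r s, ∏ i ∈ Finset.range (k r),
        ((0 - 1 * q ^ i * (x r / x s)) / (1 - q ^ (i + 1) * (x r / x s)))
        = ((-1) ^ k r * q ^ (k r).choose 2 * (x r ^ k r / x s ^ k r)) /
          qPoch q (q * (x r / x s)) (k r) := by
      intro r s
      rw [Finset.prod_div_distrib, qPoch]
      congr 1
      · rw [← div_pow, mul_right_comm, ← mul_pow, ← prod_range_mul_pow]
        exact Finset.prod_congr rfl fun i _ => by ring
      · exact Finset.prod_congr rfl fun i _ => by ring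
    simp_rw [h2, Finset.prod_div_distrib, Finset.prod_mul_distrib, Finset.prod_div_distrib]
    congr 1
    simp only [Finset.prod_const, Finset.card_univ, Fintype.card_fin]
    rw [Finset.prod_pow, Finset.prod_pow, Finset.prod_pow_eq_pow_sum, Finset.prod_pow_eq_pow_sum,
      ← pow_mul, ← pow_mul, mul_comm n, mul_comm n]
    congr 1
    rw [Finset.prod_comm]
    simp only [Finset.prod_pow_eq_pow_sum]
    rw [← Finset.prod_div_distrib]
    refine Finset.prod_congr rfl fun r _ => ?_
    rw [zpow_sub₀ (hx0 r), absIdx, zpow_natCast, ← pow_mul]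
    norm_cast
    rw [mul_comm]
  rw [milneTerm, h1, ← anFactor_mul_pow hq hx0, outerFactor, pow_add]
  ring

theorem sum_outerFactor (hn : 1 ≤ n) (hq0 : 0 < ‖q‖) (hq1 : ‖q‖ < 1) (hx0 : ∀ r, x r ≠ 0)
    (hx : ∀ r s : Fin n, r ≠ s → ∀ i : ℤ, x r / x s ≠ q ^ i) (K : ℕ) :
    ∑ k ∈ Finset.piAntidiag Finset.univ K, outerFactor q x k
      = (-1) ^ K * q ^ K.choose 2 / qPoch q q K := by
  have hq : q ≠ 0 := norm_pos_iff.1 hq0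
  rw [Finset.sum_congr rfl fun k _ => outerFactor_eq_milneTerm hq hx0 k,
    sum_milneTerm hq0 hq1 hx0 hx, Finset.prod_div_distrib, qPoch, ← prod_range_mul_pow]
  congr 1
  · refine Finset.prod_congr rfl fun i _ => ?_
    -- The product of the `u_s = 0` is `0` only because `n ≥ 1`.
    simp [Nat.one_le_iff_ne_zero.1 hn]
  · exact Finset.prod_congr rfl fun i _ => by ring

end

/-! ### Limits and bounds for q-factorials; Euler's expansion -/

section
variable {q : ℂ}

theorem qPoch_succ (q a : ℂ) (k : ℕ) : qPoch q a (k + 1) = qPoch q a k * (1 - a * q ^ k) :=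
  Finset.prod_range_succ _ _

theorem qPoch_zero (q a : ℂ) : qPoch q a 0 = 1 := Finset.prod_range_zero _

theorem summable_norm_mul_pow (hq1 : ‖q‖ < 1) (a : ℂ) : Summable fun i : ℕ => ‖-(a * q ^ i)‖ := by
  simp only [norm_neg, norm_mul, norm_pow]
  exact (summable_geometric_of_lt_one (norm_nonneg q) hq1).mul_left _

theorem tendsto_qPoch (hq1 : ‖q‖ < 1) (a : ℂ) :
    Tendsto (qPoch q a) atTop (𝓝 (qPochInf q a)) := by
  have h := (multipliable_one_add_of_summable (summable_norm_mul_pow hq1 a)).tendsto_prod_tprod_nat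
  simp only [← sub_eq_add_neg] at h
  exact h

theorem qPochInf_ne_zero (hq1 : ‖q‖ < 1) {a : ℂ} (ha : ∀ i : ℕ, 1 - a * q ^ i ≠ 0) :
    qPochInf q a ≠ 0 := by
  have h := tprod_one_add_ne_zero_of_summable (f := fun i : ℕ => -(a * q ^ i))
    (by simpa only [← sub_eq_add_neg] using ha) (summable_norm_mul_pow hq1 a)
  simp only [← sub_eq_add_neg] at h
  exact h

theorem exists_norm_le_of_tendsto {f : ℕ → ℂ} {l : ℂ} (h : Tendsto f atTop (𝓝 l)) :
    ∃ B : ℝ, 0 ≤ B ∧ ∀ k, ‖f k‖ ≤ B := by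
  obtain ⟨B, hB⟩ := h.norm.bddAbove_range
  exact ⟨B, (norm_nonneg _).trans (hB ⟨0, rfl⟩), fun k => hB ⟨k, rfl⟩⟩

theorem exists_norm_inv_qPoch_le (hq1 : ‖q‖ < 1) {a : ℂ} (ha : ∀ i : ℕ, 1 - a * q ^ i ≠ 0) :
    ∃ B : ℝ, 0 ≤ B ∧ ∀ k, ‖(qPoch q a k)⁻¹‖ ≤ B :=
  exists_norm_le_of_tendsto ((tendsto_qPoch hq1 a).inv₀ (qPochInf_ne_zero hq1 ha))

theorem one_sub_pow_succ_ne_zero (hq1 : ‖q‖ < 1) (i : ℕ) : 1 - q ^ (i + 1) ≠ 0 := by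
  rw [sub_ne_zero]
  intro h
  have := congrArg norm h
  rw [norm_one, norm_pow] at this
  exact (pow_lt_one₀ (norm_nonneg q) hq1 i.succ_ne_zero).ne' this

theorem one_sub_mul_pow_ne_zero (hq1 : ‖q‖ < 1) (i : ℕ) : 1 - q * q ^ i ≠ 0 := by
  rw [← pow_succ']; exact one_sub_pow_succ_ne_zero hq1 i

theorem qPoch_self_ne_zero (hq1 : ‖q‖ < 1) (k : ℕ) : qPoch q q k ≠ 0 :=
  Finset.prod_ne_zero_iff.2 fun i _ => one_sub_mul_pow_ne_zero hq1 i

theorem qPoch_self_mul (q : ℂ) (K J : ℕ) :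
    qPoch q q K * qPoch q (q ^ (K + 1)) J = qPoch q q (K + J) := by
  rw [qPoch, qPoch, qPoch, Finset.prod_range_add]
  congr 1
  exact Finset.prod_congr rfl fun i _ => by ring

/-- Convergent sequences whose increments decay like `‖q‖ ^ J`. -/
def GeomConv (q : ℂ) (f : ℕ → ℂ) (l : ℂ) : Prop :=
  Tendsto f atTop (𝓝 l) ∧ ∃ C : ℝ, 0 ≤ C ∧ ∀ J, ‖f (J + 1) - f J‖ ≤ C * ‖q‖ ^ J

theorem GeomConv.mul {f g : ℕ → ℂ} {l l' : ℂ} (hf : GeomConv q f l) (hg : GeomConv q g l') :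
    GeomConv q (fun J => f J * g J) (l * l') := by
  obtain ⟨hf, C, hC, hfC⟩ := hf
  obtain ⟨hg, D, hD, hgD⟩ := hg
  obtain ⟨A, hA, hfA⟩ := exists_norm_le_of_tendsto hf
  obtain ⟨B, hB, hgB⟩ := exists_norm_le_of_tendsto hg
  refine ⟨hf.mul hg, C * B + A * D, by positivity, fun J => ?_⟩
  have : f (J + 1) * g (J + 1) - f J * g J
      = (f (J + 1) - f J) * g (J + 1) + f J * (g (J + 1) - g J) := by ring
  rw [this]
  calc _ ≤ ‖f (J + 1) - f J‖ * ‖g (J + 1)‖ + ‖f J‖ * ‖g (J + 1) - g J‖ := by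
        rw [← norm_mul, ← norm_mul]; exact norm_add_le _ _
    _ ≤ (C * ‖q‖ ^ J) * B + A * (D * ‖q‖ ^ J) := by
        gcongr
        · exact hfC J
        · exact hgB _
        · exact hfA _
        · exact hgD J
    _ = _ := by ring

theorem GeomConv.pow {f : ℕ → ℂ} {l : ℂ} (hf : GeomConv q f l) (m : ℕ) :
    GeomConv q (fun J => f J ^ m) (l ^ m) := by
  induction m with
  | zero => simpa using ⟨tendsto_const_nhds, 0, le_rfl, by simp⟩
  | succ m ih => simpa only [pow_succ] using ih.mul hf

theorem GeomConv.qPoch_self (hq1 : ‖q‖ < 1) : GeomConv q (qPoch q q) (qPochInf q q) := by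
  have h := tendsto_qPoch hq1 q
  obtain ⟨A, hA, hfA⟩ := exists_norm_le_of_tendsto h
  refine ⟨h, A, hA, fun J => ?_⟩
  have : qPoch q q (J + 1) - qPoch q q J = -(qPoch q q J * (q * q ^ J)) := by
    rw [qPoch_succ]; ring
  rw [this, norm_neg, norm_mul, norm_mul, norm_pow]
  gcongr
  · exact hfA J
  · exact mul_le_of_le_one_left (by positivity) hq1.le

theorem GeomConv.inv_qPoch_self (hq1 : ‖q‖ < 1) :
    GeomConv q (fun J => (qPoch q q J)⁻¹) (qPochInf q q)⁻¹ := by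
  have h := (tendsto_qPoch hq1 q).inv₀ (qPochInf_ne_zero hq1 (one_sub_mul_pow_ne_zero hq1))
  obtain ⟨A, hA, hfA⟩ := exists_norm_le_of_tendsto h
  refine ⟨h, A, hA, fun J => ?_⟩
  have : (qPoch q q (J + 1))⁻¹ - (qPoch q q J)⁻¹ = (qPoch q q (J + 1))⁻¹ * (q * q ^ J) := by
    have h1 := qPoch_self_ne_zero hq1 J
    have h2 := one_sub_mul_pow_ne_zero hq1 J
    rw [qPoch_succ]
    field_simp
    ring
  rw [this, norm_mul, norm_mul, norm_pow]
  gcongr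
  · exact hfA _
  · exact mul_le_of_le_one_left (by positivity) hq1.le

theorem choose_two_succ (d : ℕ) : (d + 1).choose 2 = d + d.choose 2 := by
  rw [Nat.choose_succ_succ, Nat.choose_one_right]

theorem summable_pow_choose_two {r : ℝ} (h0 : 0 < r) (h1 : r < 1) :
    Summable fun d : ℕ => r ^ d.choose 2 := by
  rw [← summable_nat_add_iff 1]
  refine Summable.of_nonneg_of_le (fun _ => by positivity) (fun d => ?_)
    (summable_geometric_of_lt_one h0.le h1)
  exact pow_le_pow_of_le_one h0.le h1.le (by rw [choose_two_succ]; omega)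

/-- The coefficient `(-1)^d q^{d(d+1)/2} / (q)_d`. -/
noncomputable def eulerCoeff (q : ℂ) (d : ℕ) : ℂ :=
  (-1) ^ d * q ^ (d + 1).choose 2 / qPoch q q d

theorem exists_norm_eulerCoeff_le (hq1 : ‖q‖ < 1) :
    ∃ C : ℝ, 0 ≤ C ∧ ∀ d, ‖eulerCoeff q d‖ ≤ C * ‖q‖ ^ (d + 1).choose 2 := by
  obtain ⟨A, hA, h⟩ := exists_norm_inv_qPoch_le hq1 (one_sub_mul_pow_ne_zero hq1)
  refine ⟨A, hA, fun d => ?_⟩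
  rw [eulerCoeff, div_eq_mul_inv, norm_mul, norm_mul, norm_pow, norm_pow, norm_neg, norm_one,
    one_pow, one_mul, mul_comm]
  gcongr
  exact h d

/-- Dominated convergence in `d`, with terms extended by zero beyond `N`; the decay `|q|^(d(d+1)/2)`
of the coefficients supplies the majorant. -/
theorem tendsto_sum_antidiagonal (hq0 : 0 < ‖q‖) (hq1 : ‖q‖ < 1) (G : ℕ → ℕ → ℂ) (l : ℂ) (B : ℝ)
    (hB : ∀ d J, ‖G d J‖ ≤ B) (hG : ∀ d, Tendsto (G d) atTop (𝓝 l)) :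
    Tendsto (fun N => ∑ p ∈ Finset.HasAntidiagonal.antidiagonal N, eulerCoeff q p.1 * G p.1 p.2) atTop
      (𝓝 ((∑' d, eulerCoeff q d) * l)) := by
  obtain ⟨C, hC, hE⟩ := exists_norm_eulerCoeff_le hq1
  have hs : Summable fun d : ℕ => C * ‖q‖ ^ (d + 1).choose 2 * B :=
    (((summable_nat_add_iff 1).2 (summable_pow_choose_two hq0 hq1)).mul_left C).mul_right B
  have hB0 : 0 ≤ B := (norm_nonneg _).trans (hB 0 0)
  have key := tendsto_tsum_of_dominated_convergence (𝓕 := atTop)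
    (f := fun N d => if d < N + 1 then eulerCoeff q d * G d (N - d) else 0)
    (g := fun d => eulerCoeff q d * l) hs
    (fun d => by
      have h1 : Tendsto (fun N => eulerCoeff q d * G d (N - d)) atTop
          (𝓝 (eulerCoeff q d * l)) :=
        ((hG d).comp (tendsto_sub_atTop_nat d)).const_mul _
      refine h1.congr' ?_
      filter_upwards [eventually_ge_atTop d] with N hN
      rw [if_pos (Nat.lt_succ_of_le hN)])
    (Eventually.of_forall fun N d => by
      split_ifs
      · rw [norm_mul]
        exact mul_le_mul (hE d) (hB _ _) (norm_nonneg _) (by positivity)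
      · rw [norm_zero]; positivity)
  rw [← tsum_mul_right]
  refine key.congr fun N => ?_
  rw [Finset.Nat.sum_antidiagonal_eq_sum_range_succ fun d J => eulerCoeff q d * G d J]
  rw [tsum_eq_sum (s := Finset.range (N + 1))]
  · exact Finset.sum_congr rfl fun d hd => if_pos (Finset.mem_range.1 hd)
  · exact fun d hd => if_neg fun h => hd (Finset.mem_range.2 h)

/-- The finite `q`-binomial theorem. -/
theorem sum_antidiagonal_qBinomial (hq1 : ‖q‖ < 1) (N : ℕ) (z : ℂ) :
    ∑ p ∈ Finset.HasAntidiagonal.antidiagonal N,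
      (-1) ^ p.1 * q ^ p.1.choose 2 * z ^ p.1 / (qPoch q q p.1 * qPoch q q p.2)
      = qPoch q z N / qPoch q q N := by
  induction N generalizing z with
  | zero => simp [qPoch_zero]
  | succ N ih =>
    have hN := one_sub_mul_pow_ne_zero hq1 N
    have hP := qPoch_self_ne_zero hq1
    have h1 : qPoch q z (N + 1) = (1 - z) * qPoch q (z * q) N := by
      rw [qPoch, Finset.prod_range_succ', mul_comm, qPoch]
      congr 1
      · simp
      · exact Finset.prod_congr rfl fun i _ => by ring
    rw [h1, qPoch_succ q q, ← div_div, eq_div_iff hN, mul_div_assoc, ← ih (z * q), sub_mul, one_mul,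
      Finset.mul_sum, Finset.sum_mul]
    -- With `d + J = N + 1`, the factor `1 - q^(N+1)` splits as `q^d (1 - q^J) + (1 - q^d)`. The
    -- first part removes the last factor of `(q)_J`, the second that of `(q)_d`, giving the sum at
    -- `z q` times `1` and `-z`.
    have h2 : ∀ p ∈ Finset.HasAntidiagonal.antidiagonal (N + 1),
        (-1) ^ p.1 * q ^ p.1.choose 2 * z ^ p.1 / (qPoch q q p.1 * qPoch q q p.2) * (1 - q * q ^ N)
        = (-1) ^ p.1 * q ^ p.1.choose 2 * z ^ p.1 / (qPoch q q p.1 * qPoch q q p.2) *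
            (q ^ p.1 * (1 - q ^ p.2)) +
          (-1) ^ p.1 * q ^ p.1.choose 2 * z ^ p.1 / (qPoch q q p.1 * qPoch q q p.2) *
            (1 - q ^ p.1) := by
      intro p hp
      rw [← pow_succ', ← Finset.HasAntidiagonal.mem_antidiagonal.1 hp, pow_add]
      ring
    rw [Finset.sum_congr rfl h2, Finset.sum_add_distrib, sub_eq_add_neg, ← Finset.sum_neg_distrib]
    congr 1
    · rw [Finset.Nat.sum_antidiagonal_succ']
      simp only [pow_zero, sub_self, mul_zero, zero_add]
      refine Finset.sum_congr rfl fun p _ => ?_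
      have h3 := one_sub_mul_pow_ne_zero hq1 p.2
      have h4 := hP p.1
      have h5 := hP p.2
      rw [qPoch_succ, pow_succ' q p.2, mul_pow]
      field_simp
    · rw [Finset.Nat.sum_antidiagonal_succ]
      simp only [pow_zero, sub_self, mul_zero, zero_add]
      refine Finset.sum_congr rfl fun p _ => ?_
      have h3 := one_sub_mul_pow_ne_zero hq1 p.1
      have h4 := hP p.1
      have h5 := hP p.2
      rw [qPoch_succ, pow_succ' q p.1, mul_pow, choose_two_succ, pow_add, pow_succ, pow_succ]
      field_simp
      ring

/-- Euler's expansion of `(q)_∞`. -/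
theorem tsum_eulerCoeff (hq0 : 0 < ‖q‖) (hq1 : ‖q‖ < 1) :
    ∑' d, eulerCoeff q d = qPochInf q q := by
  have h := (GeomConv.inv_qPoch_self hq1).1
  obtain ⟨B, -, hB⟩ := exists_norm_le_of_tendsto h
  have h1 := tendsto_sum_antidiagonal hq0 hq1 (fun _ J => (qPoch q q J)⁻¹) _ B (fun _ => hB)
    fun _ => h
  -- The `q`-binomial theorem at `z = q` makes every antidiagonal sum `1`, so the limit reads `(∑
  -- eulerCoeff) / (q)_∞ = 1`.
  have h2 : ∀ N, ∑ p ∈ Finset.HasAntidiagonal.antidiagonal N, eulerCoeff q p.1 * (qPoch q q p.2)⁻¹ = 1 := by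
    intro N
    rw [← div_self (qPoch_self_ne_zero hq1 N), ← sum_antidiagonal_qBinomial hq1]
    refine Finset.sum_congr rfl fun p _ => ?_
    rw [eulerCoeff, choose_two_succ, pow_add, ← div_eq_mul_inv, div_div]
    ring
  simp only [h2] at h1
  have h3 := tendsto_nhds_unique h1 tendsto_const_nhds
  rwa [mul_inv_eq_one₀ (qPochInf_ne_zero hq1 (one_sub_mul_pow_ne_zero hq1))] at h3

/-! ### The telescoping one-dimensional expansion -/

/-- Partial sums of the one-dimensional expansion. -/
noncomputable def partialExpansion (q : ℂ) (e : ℕ) (H : ℕ → ℂ) (N : ℕ) : ℂ :=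
  ∑ p ∈ Finset.HasAntidiagonal.antidiagonal N, eulerCoeff q p.1 * (qPoch q q (2 * p.2 + p.1 + e) * H p.2)

theorem tendsto_partialExpansion (hq0 : 0 < ‖q‖) (hq1 : ‖q‖ < 1) (e : ℕ) {H : ℕ → ℂ} {l : ℂ}
    (hH : GeomConv q H l) :
    Tendsto (partialExpansion q e H) atTop (𝓝 (qPochInf q q ^ 2 * l)) := by
  have h := tendsto_qPoch hq1 q
  obtain ⟨A, hA0, hA⟩ := exists_norm_le_of_tendsto h
  obtain ⟨B, -, hB⟩ := exists_norm_le_of_tendsto hH.1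
  have h1 := tendsto_sum_antidiagonal hq0 hq1 (fun d J => qPoch q q (2 * J + d + e) * H J)
    (qPochInf q q * l) (A * B)
    (fun d J => by
      rw [norm_mul]
      exact mul_le_mul (hA _) (hB _) (norm_nonneg _) hA0)
    (fun d => (h.comp (tendsto_atTop_mono (fun J => show J ≤ 2 * J + d + e by omega) tendsto_id)).mul hH.1)
  rw [tsum_eulerCoeff hq0 hq1, ← mul_assoc, ← pow_two] at h1
  exact h1

/-- Here the difference is taken at fixed `d`, moving `J` to `J + 1`, which costs `O(|q|^J)`. Since
`C(d+1, 2) = d + C(d, 2)`, the coefficient supplies the missing `|q|^d` and a summable rest. The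
unpaired term `d = N + 1` is small by itself. -/
theorem exists_norm_partialExpansion_sub_le (hq0 : 0 < ‖q‖) (hq1 : ‖q‖ < 1) (e : ℕ) {H : ℕ → ℂ}
    {l : ℂ} (hH : GeomConv q H l) :
    ∃ C : ℝ, 0 ≤ C ∧ ∀ N,
      ‖partialExpansion q e H (N + 1) - partialExpansion q e H N‖ ≤ C * ‖q‖ ^ N := by
  obtain ⟨C, hC, hE⟩ := exists_norm_eulerCoeff_le hq1
  obtain ⟨hP, D, hD, hPD⟩ := GeomConv.qPoch_self hq1
  obtain ⟨A, hA0, hA⟩ := exists_norm_le_of_tendsto hP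
  obtain ⟨hHl, F, hF, hHF⟩ := hH
  obtain ⟨B, hB0, hB⟩ := exists_norm_le_of_tendsto hHl
  have hdiff : ∀ d J, ‖qPoch q q (2 * (J + 1) + d + e) * H (J + 1)
      - qPoch q q (2 * J + d + e) * H J‖ ≤ (2 * D * B + A * F) * ‖q‖ ^ J := by
    intro d J
    set i := 2 * J + d + e with hi
    have h1 : 2 * (J + 1) + d + e = i + 1 + 1 := by omega
    have h2 : qPoch q q (i + 1 + 1) * H (J + 1) - qPoch q q i * H J
        = (qPoch q q (i + 1 + 1) - qPoch q q (i + 1)) * H (J + 1)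
          + (qPoch q q (i + 1) - qPoch q q i) * H (J + 1)
          + qPoch q q i * (H (J + 1) - H J) := by ring
    have h3 : ∀ t, J ≤ t → ‖(qPoch q q (t + 1) - qPoch q q t) * H (J + 1)‖
        ≤ D * ‖q‖ ^ J * B := by
      intro t ht
      rw [norm_mul]
      refine mul_le_mul ((hPD t).trans ?_) (hB _) (norm_nonneg _) (by positivity)
      exact mul_le_mul_of_nonneg_left (pow_le_pow_of_le_one hq0.le hq1.le ht) hD
    have h4 : ‖qPoch q q i * (H (J + 1) - H J)‖ ≤ A * (F * ‖q‖ ^ J) := by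
      rw [norm_mul]
      exact mul_le_mul (hA _) (hHF _) (norm_nonneg _) hA0
    rw [h1, h2]
    refine (norm_add₃_le).trans ?_
    have := h3 (i + 1) (by omega)
    have := h3 i (by omega)
    linarith
  have hs := summable_pow_choose_two hq0 hq1
  refine ⟨C * (A * B) + C * (2 * D * B + A * F) * ∑' d : ℕ, ‖q‖ ^ d.choose 2, by positivity,
    fun N => ?_⟩
  unfold partialExpansion
  rw [Finset.Nat.sum_antidiagonal_succ', add_sub_assoc, ← Finset.sum_sub_distrib, add_mul]
  refine (norm_add_le _ _).trans (add_le_add ?_ ?_)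
  · rw [norm_mul, norm_mul, mul_right_comm]
    refine mul_le_mul ((hE _).trans ?_)
      (mul_le_mul (hA _) (hB _) (norm_nonneg _) hA0) (by positivity) (by positivity)
    refine mul_le_mul_of_nonneg_left (pow_le_pow_of_le_one hq0.le hq1.le ?_) hC
    rw [choose_two_succ]
    omega
  · refine (norm_sum_le _ _).trans ?_
    have h5 : ∀ p ∈ Finset.HasAntidiagonal.antidiagonal N,
        ‖eulerCoeff q p.1 * (qPoch q q (2 * (p.2 + 1) + p.1 + e) * H (p.2 + 1))
          - eulerCoeff q p.1 * (qPoch q q (2 * p.2 + p.1 + e) * H p.2)‖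
        ≤ C * (2 * D * B + A * F) * ‖q‖ ^ N * ‖q‖ ^ p.1.choose 2 := by
      intro p hp
      rw [← mul_sub, norm_mul]
      refine (mul_le_mul (hE p.1) (hdiff p.1 p.2) (norm_nonneg _) (by positivity)).trans_eq ?_
      rw [← Finset.HasAntidiagonal.mem_antidiagonal.1 hp, choose_two_succ, pow_add, pow_add]
      ring
    refine (Finset.sum_le_sum h5).trans ?_
    rw [← Finset.mul_sum, mul_right_comm]
    refine mul_le_mul_of_nonneg_right (mul_le_mul_of_nonneg_left ?_ (by positivity)) (by positivity)
    rw [Finset.Nat.sum_antidiagonal_eq_sum_range_succ fun d _ => ‖q‖ ^ d.choose 2]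
    exact hs.sum_le_tsum _ fun _ _ => by positivity

/-- Reversal of `(q^(-K))_J` with `K = d + J` held fixed: the induction moves one unit from `d` to
`J`, and the new factor `1 - q^(-(d+1))` cancels the last factor of `(q)_(d+1)`. -/
theorem qPoch_neg_pow_eq (hq0 : 0 < ‖q‖) (hq1 : ‖q‖ < 1) (J d : ℕ) :
    (-1) ^ (d + J) * q ^ (d + J).choose 2 / qPoch q q (d + J)
        * (qPoch q (q ^ (-((d + J : ℕ) : ℤ))) J * q ^ J)
      = (-1) ^ d * q ^ d.choose 2 / qPoch q q d := by
  have hq : q ≠ 0 := norm_pos_iff.1 hq0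
  induction J generalizing d with
  | zero => simp [qPoch_zero]
  | succ J ih =>
    have h := ih (d + 1)
    have h1 : d + 1 + J = d + (J + 1) := by omega
    rw [h1, choose_two_succ d, qPoch_succ q q d] at h
    have h2 := one_sub_mul_pow_ne_zero hq1 d
    have h3 := qPoch_self_ne_zero hq1 d
    have h4 : q ^ (-((d + (J + 1) : ℕ) : ℤ)) * q ^ J = (q * q ^ d)⁻¹ := by
      rw [zpow_neg, zpow_natCast, pow_add, pow_succ]
      field_simp
    rw [qPoch_succ q (q ^ _), h4]
    have h5 : ∀ a b : ℂ, a * (b * (1 - (q * q ^ d)⁻¹) * q ^ (J + 1))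
        = a * (b * q ^ J) * ((1 - (q * q ^ d)⁻¹) * q) := by intros; ring
    rw [h5, h, pow_add q d, pow_succ (-1 : ℂ)]
    generalize qPoch q q d = p at h3 ⊢
    have h6 : q ^ d ≠ 0 := pow_ne_zero _ hq
    generalize q ^ d = y at h2 h6 ⊢
    have h7 : (1 - (q * y)⁻¹) * q = -(1 - q * y) / y := by field_simp; ring
    rw [h7]
    field_simp
    rw [mul_comm y q, div_self h2]

/-- Now `J` is fixed: the term `(d, J)` of the new sum is paired with `(d - 1, J)` of the old one.
With `d + J = N + 1` the identity is `q^d (1 - q^(N+J+e+1)) + (1 - q^d) = 1 - q^(2(N+1)+e)`. -/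
theorem one_sub_mul_sum_eq (hq1 : ‖q‖ < 1) (e : ℕ) (H : ℕ → ℂ) (N : ℕ) :
    (1 - q ^ (2 * (N + 1) + e)) * ∑ p ∈ Finset.HasAntidiagonal.antidiagonal (N + 1),
      (-1) ^ p.1 * q ^ p.1.choose 2 / qPoch q q p.1 * (qPoch q q (N + p.2 + e) * H p.2)
      = partialExpansion q e H (N + 1) - partialExpansion q e H N := by
  unfold partialExpansion
  rw [Finset.Nat.sum_antidiagonal_succ, Finset.Nat.sum_antidiagonal_succ, mul_add, add_sub_assoc,
    ← Finset.sum_sub_distrib, Finset.mul_sum]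
  congr 1
  · have h1 : 2 * (N + 1) + 0 + e = N + (N + 1) + e + 1 := by omega
    have h2 : 2 * (N + 1) + e = N + (N + 1) + e + 1 := by omega
    simp only [eulerCoeff, qPoch_zero, h1, qPoch_succ, h2]
    simp
    ring
  · refine Finset.sum_congr rfl fun p hp => ?_
    have hp := Finset.HasAntidiagonal.mem_antidiagonal.1 hp
    have h1 : 2 * p.2 + (p.1 + 1) + e = N + p.2 + e + 1 := by omega
    have h2 : 2 * p.2 + p.1 + e = N + p.2 + e := by omega
    have h3 : q ^ (2 * (N + 1) + e) = q * q ^ p.1 * (q * q ^ (N + p.2 + e)) := by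
      rw [← pow_succ', ← pow_succ', ← pow_add]; congr 1; omega
    have h4 := one_sub_mul_pow_ne_zero hq1 p.1
    have h5 := qPoch_self_ne_zero hq1 p.1
    rw [eulerCoeff, eulerCoeff, h1, h2, h3, choose_two_succ (p.1 + 1), choose_two_succ p.1,
      qPoch_succ q q (N + p.2 + e), qPoch_succ q q p.1, pow_succ (-1 : ℂ), pow_add q (p.1 + 1),
      pow_add q p.1, pow_succ]
    field_simp
    ring

/-- The inner sum after the `A_n` summation, as a sum over the antidiagonal. -/
theorem sum_range_eq_sum_antidiagonal (hq0 : 0 < ‖q‖) (hq1 : ‖q‖ < 1) (K : ℕ) (g : ℕ → ℂ) :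
    (-1) ^ K * q ^ K.choose 2 / qPoch q q K * ∑ J ∈ Finset.range (K + 1),
      qPoch q (q ^ (-(K : ℤ))) J / qPoch q q J * q ^ J * g J
      = ∑ p ∈ Finset.HasAntidiagonal.antidiagonal K,
        (-1) ^ p.1 * q ^ p.1.choose 2 / qPoch q q p.1 * (g p.2 / qPoch q q p.2) := by
  rw [← Finset.Nat.sum_antidiagonal_eq_sum_range_succ
    fun J _ => qPoch q (q ^ (-(K : ℤ))) J / qPoch q q J * q ^ J * g J,
    ← Finset.Nat.sum_antidiagonal_swap, Finset.mul_sum]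
  refine Finset.sum_congr rfl fun p hp => ?_
  rw [← Finset.HasAntidiagonal.mem_antidiagonal.1 hp, ← qPoch_neg_pow_eq hq0 hq1 p.2 p.1]
  simp only [Prod.fst_swap]
  ring

/-- The value of the radial part of the summand with `|k| = K`; `e = 1` for the expansions over
all multi-indices, `e = 0` for those over the nonzero ones. -/
noncomputable def radialFactor (q : ℂ) (e : ℕ) (h : ℕ → ℂ) (K : ℕ) : ℂ :=
  (1 - q ^ (2 * K + e)) * qPoch q q (K + e - 1) * ∑ J ∈ Finset.range (K + 1),
      qPoch q (q ^ (-(K : ℤ))) J / qPoch q q J * q ^ J * (qPoch q (q ^ (K + e)) J * h J)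

theorem mul_radialFactor_succ (hq0 : 0 < ‖q‖) (hq1 : ‖q‖ < 1) (e : ℕ) (h : ℕ → ℂ) (N : ℕ) :
    (-1) ^ (N + 1) * q ^ (N + 1).choose 2 / qPoch q q (N + 1) * radialFactor q e h (N + 1)
      = partialExpansion q e (fun J => h J / qPoch q q J) (N + 1)
        - partialExpansion q e (fun J => h J / qPoch q q J) N := by
  rw [← one_sub_mul_sum_eq hq1]
  have h1 : N + 1 + e - 1 = N + e := by omega
  have h2 : ∀ J, qPoch q q (N + J + e) * (h J / qPoch q q J)
      = qPoch q q (N + e) * (qPoch q (q ^ (N + 1 + e)) J * h J) / qPoch q q J := by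
    intro J
    have := qPoch_self_mul q (N + e) J
    rw [show N + J + e = N + e + J by omega, ← this, show N + 1 + e = N + e + 1 by omega]
    ring
  simp only [h2]
  rw [← sum_range_eq_sum_antidiagonal hq0 hq1 (N + 1)
    fun J => qPoch q q (N + e) * (qPoch q (q ^ (N + 1 + e)) J * h J), radialFactor, h1,
    mul_left_comm, mul_assoc, mul_left_comm (qPoch q q (N + e))]
  congr 2
  rw [Finset.mul_sum]
  exact Finset.sum_congr rfl fun J _ => by ring

theorem radialFactor_zero_one (q : ℂ) (h : ℕ → ℂ) :
    radialFactor q 1 h 0 = partialExpansion q 1 (fun J => h J / qPoch q q J) 0 := by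
  simp [radialFactor, partialExpansion, eulerCoeff, qPoch]

/-- The factor `1 - q^0` vanishes, so the truncated subtraction in `K + e - 1` at `K = e = 0` is
harmless. -/
theorem radialFactor_zero_zero (q : ℂ) (h : ℕ → ℂ) : radialFactor q 0 h 0 = 0 := by
  simp [radialFactor]

/-- Source of the summand `1` in (2) and (4): the telescope starts at `P_0 = h 0`, while the
degree-zero term is `0`. -/
theorem partialExpansion_zero_zero (q : ℂ) (h : ℕ → ℂ) :
    partialExpansion q 0 (fun J => h J / qPoch q q J) 0 = h 0 := by
  simp [partialExpansion, eulerCoeff, qPoch]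

/-- If the increments of `f` are summable then they sum to the limit minus the initial value. -/
theorem hasSum_of_increments {t P : ℕ → ℂ} {l c : ℂ} (h0 : t 0 = P 0 - c)
    (hs : ∀ N, t (N + 1) = P (N + 1) - P N) (hl : Tendsto P atTop (𝓝 l)) (ht : Summable t) :
    HasSum t (l - c) := by
  rw [ht.hasSum_iff_tendsto_nat, ← tendsto_add_atTop_iff_nat 1]
  have : ∀ N, ∑ i ∈ Finset.range (N + 1), t i = P N - c := by
    intro N
    induction N with
    | zero => simp [h0]
    | succ N ih => rw [Finset.sum_range_succ, ih, hs]; ring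
  simp only [this]
  exact hl.sub_const c

end

/-! ### Gaussian bounds for the outer weights -/

/-- The Gaussian weight `ρ^(e² + 2 σ e) y^e`. -/
noncomputable def gaussWeight (ρ y : ℝ) (σ : ℕ) (e : ℤ) : ℝ :=
  ρ ^ (e ^ 2 + 2 * σ * e) * y ^ e

theorem gaussWeight_pos {ρ y : ℝ} (hρ : 0 < ρ) (hy : 0 < y) (σ : ℕ) (e : ℤ) :
    0 < gaussWeight ρ y σ e := by
  unfold gaussWeight; positivity

theorem summable_gaussWeight_nat {ρ z : ℝ} (hρ : 0 < ρ) (hρ1 : ρ < 1) (hz : 0 < z) :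
    Summable fun e : ℕ => ρ ^ (e ^ 2) * z ^ e := by
  have h1 : Tendsto (fun e : ℕ => ρ ^ (e + 1 + e) * z) atTop (𝓝 0) := by
    have : Tendsto (fun e : ℕ => ρ ^ (e + 1 + e)) atTop (𝓝 0) :=
      (tendsto_pow_atTop_nhds_zero_of_lt_one hρ.le hρ1).comp
        (tendsto_atTop_mono (fun e => show e ≤ e + 1 + e by omega) tendsto_id)
    simpa using this.mul_const z
  refine summable_of_ratio_test_tendsto_lt_one (l := 0) one_pos
    (Eventually.of_forall fun e => by positivity) ?_
  refine h1.congr fun e => ?_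
  rw [Real.norm_of_nonneg (by positivity), Real.norm_of_nonneg (by positivity),
    show (e + 1) ^ 2 = e ^ 2 + (e + 1 + e) by ring, pow_add ρ (e ^ 2), pow_succ z]
  have h2 : ρ ^ (e ^ 2) ≠ 0 := by positivity
  have h3 : z ^ e ≠ 0 := by positivity
  generalize ρ ^ (e + 1 + e) = a
  field_simp

theorem summable_gaussWeight {ρ y : ℝ} (hρ : 0 < ρ) (hρ1 : ρ < 1) (hy : 0 < y) (σ : ℕ) :
    Summable (gaussWeight ρ y σ) := by
  refine Summable.of_nat_of_neg ?_ ?_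
  · refine (summable_gaussWeight_nat hρ hρ1 (z := ρ ^ (2 * σ) * y) (by positivity)).congr
      fun e => ?_
    rw [gaussWeight, zpow_add₀ hρ.ne', zpow_natCast, mul_pow, ← pow_mul]
    norm_cast
    ring
  · refine (summable_gaussWeight_nat hρ hρ1 (z := (ρ ^ (2 * σ) * y)⁻¹) (by positivity)).congr
      fun e => ?_
    rw [gaussWeight, zpow_add₀ hρ.ne', zpow_neg, zpow_natCast, neg_sq, mul_neg, zpow_neg,
      inv_pow, mul_pow, ← pow_mul]
    norm_cast
    rw [mul_inv, mul_assoc, mul_assoc]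

/-- Relaxing `|k| = K` to a box factorises the sum. Each factor is part of a series over all
integers, as `i ↦ n i - K` is injective, so the bound does not depend on `K`. -/
theorem sum_prod_gaussWeight_le {n : ℕ} (hn : 1 ≤ n) {ρ : ℝ} (hρ : 0 < ρ) (hρ1 : ρ < 1)
    {y : Fin n → ℝ} (hy : ∀ r, 0 < y r) (σ : Fin n → ℕ) (K : ℕ) :
    ∑ k ∈ Finset.piAntidiag (Finset.univ : Finset (Fin n)) K,
        ∏ r, gaussWeight ρ (y r) (σ r) (n * k r - K)
      ≤ ∏ r, ∑' e : ℤ, gaussWeight ρ (y r) (σ r) e := by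
  have hpos : ∀ r e, 0 ≤ gaussWeight ρ (y r) (σ r) e := fun r e =>
    (gaussWeight_pos hρ (hy r) _ _).le
  calc _ ≤ ∑ k ∈ Fintype.piFinset fun _ : Fin n => Finset.range (K + 1),
        ∏ r, gaussWeight ρ (y r) (σ r) (n * k r - K) := by
        refine Finset.sum_le_sum_of_subset_of_nonneg ?_
          fun k _ _ => Finset.prod_nonneg fun r _ => hpos _ _
        intro k hk
        rw [mem_piAntidiag_univ] at hk
        refine Fintype.mem_piFinset.2 fun r => Finset.mem_range.2 (Nat.lt_succ_of_le ?_)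
        rw [← hk]
        exact Finset.single_le_sum (f := k) (fun _ _ => Nat.zero_le _) (Finset.mem_univ r)
    _ = ∏ r, ∑ i ∈ Finset.range (K + 1), gaussWeight ρ (y r) (σ r) (n * i - K) :=
        (Finset.prod_univ_sum (fun _ : Fin n => Finset.range (K + 1))
          fun r i => gaussWeight ρ (y r) (σ r) (n * i - K)).symm
    _ ≤ _ := by
        refine Finset.prod_le_prod (fun r _ => Finset.sum_nonneg fun i _ => hpos _ _) fun r _ => ?_
        have hinj : Function.Injective fun i : ℕ => (n * i - K : ℤ) := by
          intro i j h
          have h' : (n : ℤ) * i = n * j := by simpa using h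
          have hn0 : (n : ℤ) ≠ 0 := by omega
          exact_mod_cast mul_left_cancel₀ hn0 h'
        rw [← Finset.sum_image (f := gaussWeight ρ (y r) (σ r)) (g := fun i : ℕ => (n * i - K : ℤ))
          hinj.injOn]
        exact (summable_gaussWeight hρ hρ1 (hy r) _).sum_le_tsum _ fun _ _ => hpos _ _

/-- The exponent of `q` is a quadratic form in the deviations `n k_r - K` once `C(K, 2)` is removed.
This uses `∑ k_r = K` and `2 ∑ σ_r = n^2 - n`, valid as `σ` is a permutation. -/
theorem sum_sq_deviation {n : ℕ} (K : ℕ) (k : Fin n → ℕ) (hk : absIdx k = K)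
    (σ : Equiv.Perm (Fin n)) :
    (∑ r, (((n : ℤ) * k r - K) ^ 2 + 2 * (σ r : ℕ) * ((n : ℤ) * k r - K)))
        + 2 * n * (K.choose 2 : ℤ)
      = 2 * n * ((∑ r, (σ r : ℕ) * k r : ℕ) + n * (∑ r, (k r).choose 2 : ℕ)) := by
  have hch : ∀ t : ℕ, (2 : ℤ) * t.choose 2 = t * t - t := by
    intro t
    induction t with
    | zero => simp
    | succ t ih => rw [choose_two_succ]; push_cast; linarith
  have h1 : (∑ r, (k r : ℤ)) = K := by rw [← hk, absIdx]; push_cast; rfl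
  have h2 : 2 * (∑ r, ((k r).choose 2 : ℤ)) = ∑ r, (k r : ℤ) * k r - K := by
    rw [Finset.mul_sum, ← h1, ← Finset.sum_sub_distrib]
    exact Finset.sum_congr rfl fun r _ => hch _
  have h3 : 2 * ∑ r, ((σ r : ℕ) : ℤ) = n * n - n := by
    rw [Equiv.sum_comp σ (fun r : Fin n => ((r : ℕ) : ℤ)), Fin.sum_univ_eq_sum_range (fun i => (i : ℤ)),
      ← hch, Nat.choose_two_right, ← Finset.sum_range_id]
    push_cast
    rfl
  have h4 : (∑ r, (((n : ℤ) * k r - K) ^ 2 + 2 * (σ r : ℕ) * ((n : ℤ) * k r - K)))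
      = (n : ℤ) ^ 2 * ∑ r, (k r : ℤ) * k r - 2 * n * K * ∑ r, (k r : ℤ) + n * K ^ 2
        + 2 * n * ∑ r, ((σ r : ℕ) : ℤ) * k r - K * (2 * ∑ r, ((σ r : ℕ) : ℤ)) := by
    have h5 : (n : ℤ) * K ^ 2 = ∑ _r : Fin n, (K : ℤ) ^ 2 := by simp
    rw [h5]
    simp only [Finset.mul_sum, ← Finset.sum_add_distrib, ← Finset.sum_sub_distrib]
    exact Finset.sum_congr rfl fun r _ => by ring
  rw [h4, h3, h1]
  push_cast
  linear_combination (n : ℤ) * hch K - (n : ℤ) ^ 2 * h2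

section
variable {n : ℕ} {q : ℂ} {x : Fin n → ℂ}

/-- The numerator is a Vandermonde determinant up to sign; the triangle inequality is applied to its
Leibniz expansion. -/
theorem norm_vandRatio_le (x : Fin n → ℂ) (q : ℂ) (k : Fin n → ℕ) :
    ‖vandRatio q x k‖ ≤ ‖(∏ r : Fin n, ∏ s ∈ Finset.Ioi r, (x r - x s))⁻¹‖ *
      ∑ σ : Equiv.Perm (Fin n), ∏ r, (‖x r‖ ^ (σ r : ℕ) * ‖q‖ ^ ((σ r : ℕ) * k r)) := by
  have h1 : vandRatio q x k = (∏ r : Fin n, ∏ s ∈ Finset.Ioi r, (x r - x s))⁻¹ *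
      ∏ r : Fin n, ∏ s ∈ Finset.Ioi r, (x r * q ^ k r - x s * q ^ k s) := by
    simp only [vandRatio, Finset.prod_div_distrib]
    rw [div_eq_inv_mul]
  have h2 : ‖∏ r : Fin n, ∏ s ∈ Finset.Ioi r, (x r * q ^ k r - x s * q ^ k s)‖
      = ‖(Matrix.vandermonde fun r => x r * q ^ k r).transpose.det‖ := by
    rw [Matrix.det_transpose, Matrix.det_vandermonde, norm_prod, norm_prod]
    refine Finset.prod_congr rfl fun r _ => ?_
    rw [norm_prod, norm_prod]
    exact Finset.prod_congr rfl fun s _ => norm_sub_rev _ _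
  rw [h1, norm_mul, h2, Matrix.det_apply]
  refine mul_le_mul_of_nonneg_left ((norm_sum_le _ _).trans (Finset.sum_le_sum fun σ _ => ?_))
    (norm_nonneg _)
  have h3 : ∀ z : ℂ, ‖Equiv.Perm.sign σ • z‖ = ‖z‖ := by
    intro z
    rcases Int.units_eq_one_or (Equiv.Perm.sign σ) with h | h <;> simp [h]
  rw [h3, norm_prod]
  refine le_of_eq (Finset.prod_congr rfl fun r _ => ?_)
  rw [Matrix.transpose_apply, Matrix.vandermonde_apply, norm_pow, norm_mul, norm_pow, mul_pow,
    ← pow_mul, mul_comm (k r)]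

theorem exists_norm_inv_prod_qPoch_le (hq0 : 0 < ‖q‖) (hq1 : ‖q‖ < 1) (hx0 : ∀ r, x r ≠ 0)
    (hx : ∀ r s : Fin n, r ≠ s → ∀ i : ℤ, x r / x s ≠ q ^ i) :
    ∃ B : ℝ, 0 ≤ B ∧ ∀ k : Fin n → ℕ,
      ‖(∏ r : Fin n, ∏ s : Fin n, qPoch q (q * (x r / x s)) (k r))⁻¹‖ ≤ B := by
  have h : ∀ r s, ∃ B : ℝ, 0 ≤ B ∧ ∀ i, ‖(qPoch q (q * (x r / x s)) i)⁻¹‖ ≤ B := fun r s =>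
    exists_norm_inv_qPoch_le hq1 fun i => by
      have := one_sub_pow_mul_div_ne_zero hq0 hq1 hx0 hx r s i
      rwa [pow_succ', mul_right_comm] at this
  choose B hB0 hB using h
  refine ⟨∏ r, ∏ s, B r s, Finset.prod_nonneg fun r _ => Finset.prod_nonneg fun s _ => hB0 r s,
    fun k => ?_⟩
  simp only [← Finset.prod_inv_distrib, norm_prod]
  exact Finset.prod_le_prod (fun r _ => Finset.prod_nonneg fun s _ => norm_nonneg _) fun r _ =>
    Finset.prod_le_prod (fun s _ => norm_nonneg _) fun s _ => hB r s _

theorem norm_outerFactor_eq (hq : q ≠ 0) (hx0 : ∀ r, x r ≠ 0) (k : Fin n → ℕ) :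
    ‖outerFactor q x k‖ = ‖vandRatio q x k‖
      * ‖(∏ r : Fin n, ∏ s : Fin n, qPoch q (q * (x r / x s)) (k r))⁻¹‖
      * (‖q‖ ^ (n * ∑ r : Fin n, (k r).choose 2)
        * ∏ r : Fin n, ‖x r‖ ^ ((n : ℤ) * (k r : ℤ) - (absIdx k : ℤ))) := by
  rw [← anFactor_mul_pow hq hx0, outerFactor, div_eq_mul_inv, pow_add]
  simp only [norm_mul, norm_pow, norm_neg, norm_one, one_pow, norm_prod, norm_zpow, mul_one]
  ring

theorem weight_eq_prod_gaussWeight {r₀ ρ : ℝ} (hρ : 0 < ρ) (hr : ρ ^ (2 * n) = r₀)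
    {y : Fin n → ℝ} (k : Fin n → ℕ) (σ : Equiv.Perm (Fin n)) :
    (∏ r, r₀ ^ ((σ r : ℕ) * k r)) * (r₀ ^ (n * ∑ r : Fin n, (k r).choose 2)
        * ∏ r : Fin n, y r ^ ((n : ℤ) * (k r : ℤ) - (absIdx k : ℤ)))
      = r₀ ^ (absIdx k).choose 2 *
        ∏ r, gaussWeight ρ (y r) (σ r) (n * k r - absIdx k) := by
  have h := sum_sq_deviation (absIdx k) k rfl σ
  have hz : ∀ s : Finset (Fin n), ∀ f : Fin n → ℤ, ∏ r ∈ s, ρ ^ f r = ρ ^ ∑ r ∈ s, f r := by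
    intro s f
    induction s using Finset.cons_induction with
    | empty => simp
    | cons a s ha ih => rw [Finset.prod_cons, Finset.sum_cons, zpow_add₀ hρ.ne', ih]
  unfold gaussWeight
  rw [Finset.prod_mul_distrib, hz, ← mul_assoc, ← mul_assoc, Finset.prod_pow_eq_pow_sum, ← pow_add]
  congr 1
  rw [← hr, ← pow_mul, ← pow_mul, ← zpow_natCast, ← zpow_natCast, ← zpow_add₀ hρ.ne']
  congr 1
  push_cast at h ⊢
  linarith

/-- The outer weights of total degree `K` are uniformly of the size of the one-dimensional one. -/
theorem exists_sum_norm_outerFactor_le (hn : 1 ≤ n) (hq0 : 0 < ‖q‖) (hq1 : ‖q‖ < 1)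
    (hx0 : ∀ r, x r ≠ 0) (hx : ∀ r s : Fin n, r ≠ s → ∀ i : ℤ, x r / x s ≠ q ^ i) :
    ∃ C : ℝ, 0 ≤ C ∧ ∀ K, ∑ k ∈ Finset.piAntidiag Finset.univ K, ‖outerFactor q x k‖
      ≤ C * ‖q‖ ^ K.choose 2 := by
  have hq : q ≠ 0 := norm_pos_iff.1 hq0
  obtain ⟨B, hB0, hB⟩ := exists_norm_inv_prod_qPoch_le hq0 hq1 hx0 hx
  set V := ‖(∏ r : Fin n, ∏ s ∈ Finset.Ioi r, (x r - x s))⁻¹‖ with hV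
  have h2n : 2 * n ≠ 0 := by omega
  -- The `2n`-th root absorbs the factor `2n` by which the exponents are multiplied in
  -- `sum_sq_deviation`.
  obtain ⟨ρ, hρ, hρn⟩ : ∃ ρ : ℝ, 0 < ρ ∧ ρ ^ (2 * n) = ‖q‖ :=
    ⟨‖q‖ ^ (((2 * n : ℕ) : ℝ)⁻¹), Real.rpow_pos_of_pos hq0 _,
      Real.rpow_inv_natCast_pow hq0.le h2n⟩
  have hρ1 : ρ < 1 := by
    by_contra! h
    exact (one_le_pow₀ h (n := 2 * n)).not_gt (hρn ▸ hq1)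
  have hy : ∀ r, 0 < ‖x r‖ := fun r => norm_pos_iff.2 (hx0 r)
  set S : Equiv.Perm (Fin n) → ℝ := fun σ => ∏ r, ‖x r‖ ^ (σ r : ℕ) with hS
  set T : Equiv.Perm (Fin n) → ℝ := fun σ => ∏ r, ∑' e : ℤ, gaussWeight ρ ‖x r‖ (σ r) e with hT
  have hS0 : ∀ σ, 0 ≤ S σ := fun σ => Finset.prod_nonneg fun r _ => by positivity
  have hT0 : ∀ σ, 0 ≤ T σ := fun σ => Finset.prod_nonneg fun r _ =>
    tsum_nonneg fun e => (gaussWeight_pos hρ (hy r) _ _).le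
  refine ⟨V * B * ∑ σ, S σ * T σ,
    mul_nonneg (by positivity) (Finset.sum_nonneg fun σ _ => mul_nonneg (hS0 σ) (hT0 σ)),
    fun K => ?_⟩
  have hk : ∀ k ∈ Finset.piAntidiag (Finset.univ : Finset (Fin n)) K, ‖outerFactor q x k‖
      ≤ V * B * ‖q‖ ^ K.choose 2 * ∑ σ : Equiv.Perm (Fin n),
        S σ * ∏ r, gaussWeight ρ ‖x r‖ (σ r) (n * k r - K) := by
    intro k hk
    rw [mem_piAntidiag_univ] at hk
    rw [norm_outerFactor_eq hq hx0]
    have h1 := mul_le_mul (norm_vandRatio_le x q k) (hB k) (norm_nonneg _) (by positivity)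
    have h2 : 0 ≤ ‖q‖ ^ (n * ∑ r : Fin n, (k r).choose 2)
        * ∏ r : Fin n, ‖x r‖ ^ ((n : ℤ) * (k r : ℤ) - (absIdx k : ℤ)) := by positivity
    refine (mul_le_mul_of_nonneg_right h1 h2).trans_eq ?_
    have h3 : ∀ σ : Equiv.Perm (Fin n), (∏ r, (‖x r‖ ^ (σ r : ℕ) * ‖q‖ ^ ((σ r : ℕ) * k r))) *
        (‖q‖ ^ (n * ∑ r : Fin n, (k r).choose 2)
          * ∏ r : Fin n, ‖x r‖ ^ ((n : ℤ) * (k r : ℤ) - (absIdx k : ℤ)))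
        = ‖q‖ ^ K.choose 2 * (S σ * ∏ r, gaussWeight ρ ‖x r‖ (σ r) (n * k r - K)) := by
      intro σ
      rw [Finset.prod_mul_distrib, mul_assoc (∏ r, ‖x r‖ ^ (σ r : ℕ)),
        weight_eq_prod_gaussWeight hρ hρn, hk]
      ring
    rw [← hV, mul_right_comm V _ B, mul_assoc (V * B), Finset.sum_mul,
      Finset.sum_congr rfl fun σ _ => h3 σ, ← Finset.mul_sum, ← mul_assoc]
  refine (Finset.sum_le_sum hk).trans ?_
  rw [← Finset.mul_sum, Finset.sum_comm, mul_right_comm]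
  refine mul_le_mul_of_nonneg_right (mul_le_mul_of_nonneg_left (Finset.sum_le_sum fun σ _ => ?_)
    (by positivity)) (by positivity)
  rw [← Finset.mul_sum]
  exact mul_le_mul_of_nonneg_left
    (sum_prod_gaussWeight_le hn hρ hρ1 hy (fun r => (σ r : ℕ)) K) (hS0 σ)

end

/-! ### Summation over multi-indices -/

section
variable {n : ℕ} {q : ℂ} {x : Fin n → ℂ}

theorem summable_of_sum_piAntidiag_le {f : (Fin n → ℕ) → ℂ} {a : ℕ → ℝ} (ha : Summable a)
    (hf : ∀ K, ∑ k ∈ Finset.piAntidiag Finset.univ K, ‖f k‖ ≤ a K) : Summable f := by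
  have ha0 : ∀ K, 0 ≤ a K := fun K =>
    (Finset.sum_nonneg fun _ _ => norm_nonneg _).trans (hf K)
  refine Summable.of_norm (summable_of_sum_le (c := ∑' K, a K) (fun _ => norm_nonneg _) fun s => ?_)
  rw [← Finset.sum_fiberwise_of_maps_to (t := s.image absIdx) (g := absIdx)
    fun k hk => Finset.mem_image_of_mem _ hk]
  refine (Finset.sum_le_sum fun K _ => ?_).trans (ha.sum_le_tsum _ fun K _ => ha0 K)
  refine (Finset.sum_le_sum_of_subset_of_nonneg ?_ fun _ _ _ => norm_nonneg _).trans (hf K)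
  intro k hk
  exact mem_piAntidiag_univ.2 (Finset.mem_filter.1 hk).2

theorem hasSum_of_sum_piAntidiag {f : (Fin n → ℕ) → ℂ} {l : ℂ} (hf : Summable f)
    (h : HasSum (fun K => ∑ k ∈ Finset.piAntidiag Finset.univ K, f k) l) : HasSum f l := by
  have h1 := hf.hasSum.tsum_fiberwise absIdx
  have h2 : ∀ K, ∑' k : (absIdx ⁻¹' {K} : Set (Fin n → ℕ)), f k
      = ∑ k ∈ Finset.piAntidiag Finset.univ K, f k := by
    intro K
    have : (absIdx ⁻¹' {K} : Set (Fin n → ℕ)) =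
        ((Finset.piAntidiag Finset.univ K : Finset (Fin n → ℕ)) : Set (Fin n → ℕ)) := by
      ext k
      rw [Finset.mem_coe, mem_piAntidiag_univ]
      rfl
    rw [this]
    exact Finset.tsum_subtype' _ f
  simp only [h2] at h1
  rw [h.unique h1]
  exact hf.hasSum

/-- The constant `c` is the gap between `P_0` and the degree-zero term: `0` for `e = 1`, and `h 0 =
1` for `e = 0`. -/
theorem hasSum_outerFactor_mul_radialFactor (hn : 1 ≤ n) (hq0 : 0 < ‖q‖) (hq1 : ‖q‖ < 1)
    (hx0 : ∀ r, x r ≠ 0) (hx : ∀ r s : Fin n, r ≠ s → ∀ i : ℤ, x r / x s ≠ q ^ i)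
    (e : ℕ) {h : ℕ → ℂ} {l : ℂ} (hh : GeomConv q (fun J => h J / qPoch q q J) l) (c : ℂ)
    (hc : radialFactor q e h 0 = partialExpansion q e (fun J => h J / qPoch q q J) 0 - c) :
    HasSum (fun k => outerFactor q x k * radialFactor q e h (absIdx k))
      (qPochInf q q ^ 2 * l - c) := by
  set t : ℕ → ℂ := fun K => (-1) ^ K * q ^ K.choose 2 / qPoch q q K * radialFactor q e h K with ht
  have ht0 : t 0 = partialExpansion q e (fun J => h J / qPoch q q J) 0 - c := by
    simp [ht, qPoch_zero, hc]
  have htsucc : ∀ N, t (N + 1) = _ := mul_radialFactor_succ hq0 hq1 e h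
  have hts : Summable fun K => ‖t K‖ := by
    obtain ⟨C, -, hC⟩ := exists_norm_partialExpansion_sub_le hq0 hq1 e hh
    rw [← summable_nat_add_iff 1]
    refine Summable.of_nonneg_of_le (fun _ => norm_nonneg _) (fun N => ?_)
      ((summable_geometric_of_lt_one hq0.le hq1).mul_left C)
    rw [htsucc]
    exact hC N
  have htsum := hasSum_of_increments ht0 htsucc (tendsto_partialExpansion hq0 hq1 e hh) hts.of_norm
  obtain ⟨C, hC0, hC⟩ := exists_sum_norm_outerFactor_le hn hq0 hq1 hx0 hx
  obtain ⟨A, hA0, hA⟩ := exists_norm_le_of_tendsto (tendsto_qPoch hq1 q)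
  refine hasSum_of_sum_piAntidiag
    (summable_of_sum_piAntidiag_le (hts.mul_left (C * A)) fun K => ?_) ?_
  · have h1 : ∀ k ∈ Finset.piAntidiag (Finset.univ : Finset (Fin n)) K,
        ‖outerFactor q x k * radialFactor q e h (absIdx k)‖
          = ‖outerFactor q x k‖ * ‖radialFactor q e h K‖ := fun k hk => by
      rw [mem_piAntidiag_univ.1 hk, norm_mul]
    -- Hence the norms in degree `K` add up to at most a constant times `‖t K‖`, the collapsed
    -- one-variable term.
    have h2 : ‖q‖ ^ K.choose 2 * ‖radialFactor q e h K‖ = ‖qPoch q q K‖ * ‖t K‖ := by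
      rw [← norm_mul, ht]
      dsimp only
      rw [← mul_assoc, mul_div_cancel₀ _ (qPoch_self_ne_zero hq1 K)]
      simp
    rw [Finset.sum_congr rfl h1, ← Finset.sum_mul]
    refine (mul_le_mul_of_nonneg_right (hC K) (norm_nonneg _)).trans ?_
    rw [mul_assoc, h2, mul_assoc]
    exact mul_le_mul_of_nonneg_left (mul_le_mul_of_nonneg_right (hA K) (norm_nonneg _)) hC0
  · convert htsum using 2 with K
    simp only [ht]
    rw [← sum_outerFactor hn hq0 hq1 hx0 hx, Finset.sum_mul]
    exact Finset.sum_congr rfl fun k hk => by rw [mem_piAntidiag_univ.1 hk]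

theorem hasSum_fullTerm (hn : 1 ≤ n) (hq0 : 0 < ‖q‖) (hq1 : ‖q‖ < 1)
    (hx0 : ∀ r, x r ≠ 0) (hx : ∀ r s : Fin n, r ≠ s → ∀ i : ℤ, x r / x s ≠ q ^ i)
    {h : ℕ → ℂ} {l : ℂ} (hh : GeomConv q (fun J => h J / qPoch q q J) l) :
    HasSum (fullTerm q x fun K J => qPoch q (q ^ (K + 1)) J * h J) (qPochInf q q ^ 2 * l) := by
  have h1 := hasSum_outerFactor_mul_radialFactor hn hq0 hq1 hx0 hx 1 hh 0
    (by rw [radialFactor_zero_one, sub_zero])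
  rw [sub_zero] at h1
  convert h1 using 2 with k
  rw [fullTerm, innerSum_eq hq0 hq1 hx0 hx, radialFactor, Nat.add_sub_cancel]
  ring

theorem hasSum_posTerm (hn : 1 ≤ n) (hq0 : 0 < ‖q‖) (hq1 : ‖q‖ < 1)
    (hx0 : ∀ r, x r ≠ 0) (hx : ∀ r s : Fin n, r ≠ s → ∀ i : ℤ, x r / x s ≠ q ^ i)
    {h : ℕ → ℂ} {l : ℂ} (hh : GeomConv q (fun J => h J / qPoch q q J) l) (h0 : h 0 = 1) :
    HasSum (fun k : {k : Fin n → ℕ // 1 ≤ absIdx k} =>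
      posTerm q x (fun K J => qPoch q (q ^ K) J * h J) k) (qPochInf q q ^ 2 * l - 1) := by
  have h1 := hasSum_outerFactor_mul_radialFactor hn hq0 hq1 hx0 hx 0 hh 1
    (by rw [radialFactor_zero_zero, partialExpansion_zero_zero, h0, sub_self])
  have h2 : ∀ k, posTerm q x (fun K J => qPoch q (q ^ K) J * h J) k
      = outerFactor q x k * radialFactor q 0 h (absIdx k) := by
    intro k
    rw [posTerm, innerSum_eq hq0 hq1 hx0 hx, radialFactor]
    simp only [add_zero]
    ring
  simp only [h2]
  -- The term with `|k| = 0` vanishes, so the sum may run over all multi-indices.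
  refine (hasSum_subtype_iff_of_support_subset (s := {k : Fin n → ℕ | 1 ≤ absIdx k})
    (f := fun k => outerFactor q x k * radialFactor q 0 h (absIdx k)) ?_).2 h1
  intro k hk
  by_contra hk0
  have hk0 : absIdx k = 0 := by simpa using hk0
  refine hk ?_
  dsimp only
  rw [hk0, radialFactor_zero_zero, mul_zero]

/-- The quotient form, rather than the power `m - 1`, covers `m = 0`. -/
theorem geomConv_pow_div (hq1 : ‖q‖ < 1) (m : ℕ) :
    GeomConv q (fun J => qPoch q q J ^ m / qPoch q q J) (qPochInf q q ^ m / qPochInf q q) := by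
  simpa only [div_eq_mul_inv] using
    ((GeomConv.qPoch_self hq1).pow m).mul (GeomConv.inv_qPoch_self hq1)

theorem geomConv_inv_pow_div (hq1 : ‖q‖ < 1) (m : ℕ) :
    GeomConv q (fun J => (qPoch q q J ^ (m + 1))⁻¹ / qPoch q q J)
      ((qPochInf q q ^ (m + 1))⁻¹ / qPochInf q q) := by
  simpa only [div_eq_mul_inv, inv_pow] using
    ((GeomConv.inv_qPoch_self hq1).pow (m + 1)).mul (GeomConv.inv_qPoch_self hq1)

end

end

theorem mainTheorem8 (n : ℕ) (hn : 1 ≤ n) (q : ℂ) (hq0 : 0 < ‖q‖) (hq1 : ‖q‖ < 1)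
    (x : Fin n → ℂ) (hx0 : ∀ r, x r ≠ 0)
    (hx : ∀ r s : Fin n, r ≠ s → ∀ i : ℤ, x r / x s ≠ q ^ i) (m : ℕ) :
    ((Summable fun k : Fin n → ℕ =>
          fullTerm q x (fun K J => qPoch q (q ^ (K + 1)) J * qPoch q q J ^ m) k) ∧
      qPochInf q q ^ (m + 1) =
        ∑' k : Fin n → ℕ,
          fullTerm q x (fun K J => qPoch q (q ^ (K + 1)) J * qPoch q q J ^ m) k) ∧
    ((Summable fun k : {k : Fin n → ℕ // 1 ≤ absIdx k} =>
          posTerm q x (fun K J => qPoch q (q ^ K) J * qPoch q q J ^ m) k) ∧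
      qPochInf q q ^ (m + 1) =
        1 + ∑' k : {k : Fin n → ℕ // 1 ≤ absIdx k},
          posTerm q x (fun K J => qPoch q (q ^ K) J * qPoch q q J ^ m) k) ∧
    ((Summable fun k : Fin n → ℕ =>
          fullTerm q x (fun K J => qPoch q (q ^ (K + 1)) J / qPoch q q J ^ (m + 1)) k) ∧
      1 / qPochInf q q ^ m =
        ∑' k : Fin n → ℕ,
          fullTerm q x (fun K J => qPoch q (q ^ (K + 1)) J / qPoch q q J ^ (m + 1)) k) ∧
    ((Summable fun k : {k : Fin n → ℕ // 1 ≤ absIdx k} =>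
          posTerm q x (fun K J => qPoch q (q ^ K) J / qPoch q q J ^ (m + 1)) k) ∧
      1 / qPochInf q q ^ m =
        1 + ∑' k : {k : Fin n → ℕ // 1 ≤ absIdx k},
          posTerm q x (fun K J => qPoch q (q ^ K) J / qPoch q q J ^ (m + 1)) k) := by
  have hP : qPochInf q q ≠ 0 := qPochInf_ne_zero hq1 (one_sub_mul_pow_ne_zero hq1)
  have h1 : qPochInf q q ^ 2 * (qPochInf q q ^ m / qPochInf q q) = qPochInf q q ^ (m + 1) := by
    field_simp
    rw [pow_succ']
  have h2 : qPochInf q q ^ 2 * ((qPochInf q q ^ (m + 1))⁻¹ / qPochInf q q)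
      = 1 / qPochInf q q ^ m := by
    field_simp
    rw [pow_succ']
  have H1 := hasSum_fullTerm hn hq0 hq1 hx0 hx (geomConv_pow_div hq1 m)
  have H2 := hasSum_posTerm hn hq0 hq1 hx0 hx (geomConv_pow_div hq1 m) (by simp [qPoch_zero])
  have H3 := hasSum_fullTerm hn hq0 hq1 hx0 hx (geomConv_inv_pow_div hq1 m)
  have H4 := hasSum_posTerm hn hq0 hq1 hx0 hx (geomConv_inv_pow_div hq1 m) (by simp [qPoch_zero])
  rw [h1] at H1 H2
  rw [h2] at H3 H4
  simp only [← div_eq_mul_inv] at H3 H4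
  refine ⟨⟨H1.summable, H1.tsum_eq.symm⟩, ⟨H2.summable, ?_⟩, ⟨H3.summable, H3.tsum_eq.symm⟩,
    ⟨H4.summable, ?_⟩⟩
  · rw [H2.tsum_eq, add_sub_cancel]
  · rw [H4.tsum_eq, add_sub_cancel]
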